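/- **Conventions.** All Hilbert spaces are complex and representations of $C^*$-algebras are $*$-representations; $M(\mathcal B)$ denotes the multiplier algebra of a $C^*$-algebra $\mathcal B$. A representation $\pi:\mathcal B\to B(\mathcal H)$ is non-degenerate if $\pi(\mathcal B)\mathcal H$ spans a dense subspace of $\mathcal H$; its unique extension to $M(\mathcal B)$ is denoted $\tilde\pi$. A morphism $\varphi:\mathcal B\to M(\mathcal C)$ is non-degenerate if $\varphi(\mathcal B)\mathcal C$ spans a dense subspace of $\mathcal C$; its unique extension to $M(\mathcal B)$ is denoted $\tilde\varphi$. Let $G$ be a topological group. A *host algebra* for $G$ is a pair $(\mathcal L,\eta)$ of a $C^*$-algebra $\mathcal L$ and a group homomorphism $\eta:G\to U(M(\mathcal L))$ such that for each Hilbert space $\mathcal H$ and each non-degenerate representation $\pi$ of $\mathcal L$ on $\mathcal H$ the unitary representation $\tilde\pi\circ\eta$ of $G$ is strongly continuous, and $\pi\mapsto\tilde\pi\circ\eta$ is injective on the non-degenerate representations of $\mathcal L$ on $\mathcal H$. A continuous unitary representation $U$ of $G$ of the form $U=\tilde\pi\circ\eta$ is called an *$\mathcal L$-representation*, and then $U_{\mathcal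 L}:=\pi$. Let $\mathcal A$ be a $C^*$-algebra and $\alpha:G\to\operatorname{Aut}(\mathcal A)$ a group homomorphism (a *$C^*$-action*; no continuity is assumed). A *covariant representation* of $(\mathcal A,G,\alpha)$ on $\mathcal H$ is a pair $(\pi,U)$ of a non-degenerate representation $\pi$ of $\mathcal A$ and a strongly continuous unitary representation $U$ of $G$ on $\mathcal H$ with $U(g)\pi(A)U(g)^*=\pi(\alpha_g(A))$ for all $g\in G$, $A\in\mathcal A$. It is a *covariant $\mathcal L$-representation* if $U$ is an $\mathcal L$-representation, and a *cross representation* for $(\alpha,\mathcal L)$ if moreover $\pi(\mathcal A)U_{\mathcal L}(\mathcal L)\subseteq U_{\mathcal L}(\mathcal L)B(\mathcal H)$. A *crossed product host* for $(\alpha,\mathcal L)$ is a triple $(\mathcal C,\eta_{\mathcal A},\eta_{\mathcal L})$ of a $C^*$-algebra $\mathcal C$ and morphisms $\eta_{\mathcal A}:\mathcal A\to M(\mathcal C)$, $\eta_{\mathcal L}:\mathcal L\to M(\mathcal C)$ such that $\eta_{\mathcal L}$ is non-degenerate, $\tilde\eta_{\mathcal L}(\eta(g))\,\eta_{\mathcal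 A}(A)\,\tilde\eta_{\mathcal L}(\eta(g))^*=\eta_{\mathcal A}(\alpha_g(A))$ for all $A\in\mathcal A$, $g\in G$, and $\eta_{\mathcal A}(\mathcal A)\eta_{\mathcal L}(\mathcal L)$ is contained in $\mathcal C$ and generates $\mathcal C$ as a $C^*$-algebra. It is *full* if for every covariant $\mathcal L$-representation $(\pi,U)$ on any Hilbert space $\mathcal H$ there is a unique representation $\rho:\mathcal C\to B(\mathcal H)$ with $\rho(\eta_{\mathcal A}(A)\eta_{\mathcal L}(L))=\pi(A)U_{\mathcal L}(L)$ for all $A\in\mathcal A$, $L\in\mathcal L$. Let $G_d$ be the group $G$ with the discrete topology and $\mathcal A\rtimes_\alpha G_d$ the (full) crossed product $C^*$-algebra, spanned densely by the elements $A\delta_g$. Let $\mathfrak S_{\mathcal L}$ be the set of states $\omega$ of $\mathcal A\rtimes_\alpha G_d$ whose GNS representation $\rho_\omega$ on $\mathcal H_\omega$ is of the form $\rho_\omega(A\delta_g)=\pi_\omega(A)U_\omega(g)$ for a (then unique) covariant $\mathcal L$-representation $(\pi_\omega,U_\omega)$ of $(\mathcal A,G,\alpha)$. The *universal covariant $\mathcal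 L$-representation* is $(\pi_u,U_u)=\bigoplus_{\omega\in\mathfrak S_{\mathcal L}}(\pi_\omega,U_\omega)$ on $\mathcal H_u=\bigoplus_{\omega\in\mathfrak S_{\mathcal L}}\mathcal H_\omega$. **Theorem (Existence Theorem).** Let $(\mathcal L,\eta)$ be a host algebra for the topological group $G$ and let $\alpha:G\to\operatorname{Aut}(\mathcal A)$ be a $C^*$-action. Then the following are equivalent: 1. There exists a full crossed product host $(\mathcal C,\eta_{\mathcal A},\eta_{\mathcal L})$ for $(\alpha,\mathcal L)$. 2. The universal covariant $\mathcal L$-representation $(\pi_u,U_u)$ of $(\mathcal A,G,\alpha)$ on $\mathcal H_u$ is a cross representation. 3. For every Hilbert space $\mathcal H$, every covariant $\mathcal L$-representation of $(\mathcal A,G,\alpha)$ on $\mathcal H$ is a cross representation. -/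

import Mathlib

open Filter Topology
open scoped MultiplierAlgebra ComplexOrder ENNReal InnerProductSpace

universe u

noncomputable section

/-! ## Multiplier algebras and multiplier extensions -/

section MultiplierExtension

/-- In a `C⋆`-algebra an element annihilated by all left multiplications vanishes. -/
theorem eq_of_forall_mul_left_eq {A : Type*} [NonUnitalCStarAlgebra A] {x y : A}
    (h : ∀ c : A, c * x = c * y) : x = y := by
  rw [← sub_eq_zero]
  have h1 : star (x - y) * (x - y) = 0 := by rw [mul_sub, h, sub_self]
  exact CStarRing.star_mul_self_eq_zero_iff _ |>.mp h1

theorem multiplier_fst_mul {A : Type*} [NonUnitalCStarAlgebra A] (M : 𝓜(ℂ, A)) (a b : A) :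
    M.fst (a * b) = M.fst a * b := by
  refine eq_of_forall_mul_left_eq fun c => ?_
  rw [← M.central, ← mul_assoc, M.central, mul_assoc]

theorem multiplier_mul_coe {A : Type*} [NonUnitalCStarAlgebra A] (M : 𝓜(ℂ, A)) (a : A) :
    M * (a : 𝓜(ℂ, A)) = ((M.fst a : A) : 𝓜(ℂ, A)) := by
  ext b <;> simp [multiplier_fst_mul, M.central]

theorem star_multiplier_fst_mul {A : Type*} [NonUnitalCStarAlgebra A] (M : 𝓜(ℂ, A)) (a b : A) :
    star (M.fst a) * b = star a * (star M).fst b := by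
  rw [DoubleCentralizer.star_fst, ← star_mul, M.central, star_mul, star_star]

/-- Let a `C⋆`-algebra `A` act on a Banach space `X` by contractions such that the span of
`φ(A)X` is dense.  Every multiplier `M` of `A` then acts on `X`, by the unique bounded operator with
`φ(a)x ↦ φ(M a)x`. -/
theorem exists_multiplier_action {A X : Type*} [NonUnitalCStarAlgebra A]
    [NormedAddCommGroup X] [NormedSpace ℂ X] [CompleteSpace X]
    (φ : A →ₙₐ[ℂ] (X →L[ℂ] X)) (hφ : ∀ a, ‖φ a‖ ≤ ‖a‖)
    (hd : Dense (Submodule.span ℂ {x : X | ∃ a y, x = φ a y} : Set X)) (M : 𝓜(ℂ, A)) :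
    ∃ T : X →L[ℂ] X, ∀ a x, T (φ a x) = φ (M.fst a) x := by
  let _ := CStarAlgebra.spectralOrder A
  have _ := CStarAlgebra.spectralOrderedRing A
  let e : ((A × X) →₀ ℂ) →ₗ[ℂ] X := Finsupp.linearCombination ℂ fun p : A × X => φ p.1 p.2
  let f : ((A × X) →₀ ℂ) →ₗ[ℂ] X :=
    Finsupp.linearCombination ℂ fun p : A × X => φ (M.fst p.1) p.2
  have he : DenseRange e := by
    have h1 : Set.range e = (Submodule.span ℂ {x : X | ∃ a y, x = φ a y} : Set X) := by
      have h2 : {x : X | ∃ a y, x = φ a y} = Set.range fun p : A × X => φ p.1 p.2 := by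
        ext x
        simp [eq_comm]
      rw [h2, ← Finsupp.range_linearCombination]
      rfl
    rw [DenseRange, h1]
    exact hd
  have hcont : Continuous φ :=
    AddMonoidHomClass.continuous_of_bound φ 1 (by simpa only [one_mul] using hφ)
  have hb : ∀ v, ‖f v‖ ≤ ‖M‖ * ‖e v‖ := by
    intro v
    have happ := CStarAlgebra.increasingApproximateUnit A
    have := happ.neBot
    have ht : Tendsto (fun u : A => φ (M.fst u) (e v)) (CStarAlgebra.approximateUnit A)
        (𝓝 (f v)) := by
      have h1 : ∀ u : A, φ (M.fst u) (e v) = v.sum fun p c => c • φ (M.fst (u * p.1)) p.2 := by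
        intro u
        simp only [e, Finsupp.linearCombination_apply, Finsupp.sum, map_sum, map_smul]
        refine Finset.sum_congr rfl fun p _ => ?_
        rw [multiplier_fst_mul, map_mul]
        rfl
      simp only [h1]
      simp only [f, Finsupp.linearCombination_apply, Finsupp.sum]
      refine tendsto_finsetSum _ fun p _ => ?_
      have h2 : Continuous fun w : A => v p • φ (M.fst w) p.2 := by fun_prop
      exact (h2.tendsto p.1).comp (happ.tendsto_mul_right p.1)
    refine le_of_tendsto ht.norm ?_
    filter_upwards [happ.eventually_norm] with u hu
    calc ‖φ (M.fst u) (e v)‖ ≤ ‖φ (M.fst u)‖ * ‖e v‖ := (φ (M.fst u)).le_opNorm _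
      _ ≤ (‖M.fst‖ * ‖u‖) * ‖e v‖ := by
          gcongr
          exact (hφ _).trans (M.fst.le_opNorm u)
      _ ≤ (‖M.fst‖ * 1) * ‖e v‖ := by gcongr
      _ = ‖M‖ * ‖e v‖ := by rw [mul_one, DoubleCentralizer.norm_fst]
  refine ⟨f.extendOfNorm e, fun a x => ?_⟩
  have h := LinearMap.extendOfNorm_eq he ⟨_, hb⟩ (Finsupp.single (a, x) 1)
  simpa [e, f] using h

theorem clm_eq_of_dense_span {X Y : Type*}
    [NormedAddCommGroup X] [NormedSpace ℂ X] [NormedAddCommGroup Y] [NormedSpace ℂ Y]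
    {s : Set X} (hd : Dense (Submodule.span ℂ s : Set X)) {S T : X →L[ℂ] Y}
    (h : ∀ x ∈ s, S x = T x) : S = T :=
  ContinuousLinearMap.ext_on hd h

end MultiplierExtension

/-! ## Representations -/

/-- A non-degenerate representation of the `C⋆`-algebra `A` on the Hilbert space `H`. -/
structure NDRep (A : Type*) [NonUnitalCStarAlgebra A]
    (H : Type*) [NormedAddCommGroup H] [InnerProductSpace ℂ H] [CompleteSpace H] where
  hom : A →⋆ₙₐ[ℂ] (H →L[ℂ] H)
  nondegenerate : Dense (Submodule.span ℂ {x : H | ∃ a y, x = hom a y} : Set H)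

namespace NDRep

variable {A : Type*} [NonUnitalCStarAlgebra A]
  {H : Type*} [NormedAddCommGroup H] [InnerProductSpace ℂ H] [CompleteSpace H]

theorem exists_extension (π : NDRep A H) (M : 𝓜(ℂ, A)) :
    ∃ T : H →L[ℂ] H, ∀ a x, T (π.hom a x) = π.hom (M.fst a) x :=
  exists_multiplier_action π.hom.toNonUnitalAlgHom
    (fun a => NonUnitalStarAlgHom.norm_apply_le π.hom a) π.nondegenerate M

/-- The operator `π̃(M)`. -/
def extOp (π : NDRep A H) (M : 𝓜(ℂ, A)) : H →L[ℂ] H := (π.exists_extension M).choose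

theorem extOp_apply (π : NDRep A H) (M : 𝓜(ℂ, A)) (a : A) (x : H) :
    π.extOp M (π.hom a x) = π.hom (M.fst a) x := (π.exists_extension M).choose_spec a x

theorem eq_of_apply_eq (π : NDRep A H) {S T : H →L[ℂ] H}
    (h : ∀ a x, S (π.hom a x) = T (π.hom a x)) : S = T := by
  refine clm_eq_of_dense_span π.nondegenerate ?_
  rintro _ ⟨a, y, rfl⟩
  exact h a y

theorem extOp_unique (π : NDRep A H) (M : 𝓜(ℂ, A)) (T : H →L[ℂ] H)
    (h : ∀ a x, T (π.hom a x) = π.hom (M.fst a) x) : π.extOp M = T :=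
  π.eq_of_apply_eq fun a x => by rw [extOp_apply, h]

theorem extOp_star (π : NDRep A H) (M : 𝓜(ℂ, A)) :
    π.extOp (star M) = star (π.extOp M) := by
  rw [ContinuousLinearMap.star_eq_adjoint, ContinuousLinearMap.eq_adjoint_iff]
  intro x y
  have key : ∀ (a : A) (ξ : H) (b : A) (ζ : H),
      ⟪π.hom a ξ, π.extOp M (π.hom b ζ)⟫_ℂ = ⟪π.extOp (star M) (π.hom a ξ), π.hom b ζ⟫_ℂ := by
    intro a ξ b ζ
    have hadj : ∀ (c : A) (v w : H), ⟪π.hom c v, w⟫_ℂ = ⟪v, π.hom (star c) w⟫_ℂ := by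
      intro c v w
      rw [map_star, ContinuousLinearMap.star_eq_adjoint, ContinuousLinearMap.adjoint_inner_right]
    have hl : ∀ (S T : H →L[ℂ] H) (z : H), S (T z) = (S * T) z := fun _ _ _ => rfl
    rw [extOp_apply, extOp_apply, hadj, hadj, hl, hl, ← map_mul, ← map_mul, star_multiplier_fst_mul, star_star]
  have h1 : ∀ (a : A) (ξ : H), (innerSL ℂ (π.hom a ξ)).comp (π.extOp M) =
      innerSL ℂ (π.extOp (star M) (π.hom a ξ)) := by
    intro a ξ
    refine clm_eq_of_dense_span π.nondegenerate ?_
    rintro _ ⟨b, ζ, rfl⟩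
    simpa using key a ξ b ζ
  have h2 : (innerSL ℂ (π.extOp M y) : H →L[ℂ] ℂ) =
      (innerSL ℂ y).comp (π.extOp (star M)) := by
    refine clm_eq_of_dense_span π.nondegenerate ?_
    rintro _ ⟨a, ξ, rfl⟩
    have := congrArg (fun T : H →L[ℂ] ℂ => T y) (h1 a ξ)
    simp only [ContinuousLinearMap.comp_apply, innerSL_apply_apply] at this
    have h3 := congrArg (starRingEnd ℂ) this
    simpa only [inner_conj_symm, ContinuousLinearMap.comp_apply, innerSL_apply_apply] using h3
  have h3 := congrArg (fun T : H →L[ℂ] ℂ => starRingEnd ℂ (T x)) h2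
  simpa only [inner_conj_symm, ContinuousLinearMap.comp_apply, innerSL_apply_apply] using h3.symm

/-- The multiplier extension `π̃ : M(A) → B(H)` of a non-degenerate representation `π`. -/
def ext (π : NDRep A H) : 𝓜(ℂ, A) →⋆ₐ[ℂ] (H →L[ℂ] H) where
  toFun := π.extOp
  map_one' := π.extOp_unique _ _ fun a x => rfl
  map_zero' := π.extOp_unique _ _ fun a x => by simp
  map_add' M N := π.extOp_unique _ _ fun a x => by simp [extOp_apply]
  map_mul' M N := π.extOp_unique _ _ fun a x => by simp [extOp_apply]
  commutes' r := π.extOp_unique _ _ fun a x => by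
    simp [Algebra.algebraMap_eq_smul_one]
  map_star' M := π.extOp_star M

theorem ext_apply (π : NDRep A H) (M : 𝓜(ℂ, A)) (a : A) (x : H) :
    π.ext M (π.hom a x) = π.hom (M.fst a) x := π.extOp_apply M a x

/-- `π̃` extends `π`. -/
theorem ext_coe (π : NDRep A H) (a : A) : π.ext (a : 𝓜(ℂ, A)) = π.hom a :=
  π.extOp_unique _ _ fun b x => by simp

/-- `π̃` is the only extension of `π`. -/
theorem ext_unique (π : NDRep A H) (ψ : 𝓜(ℂ, A) →⋆ₐ[ℂ] (H →L[ℂ] H))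
    (hψ : ∀ a : A, ψ (a : 𝓜(ℂ, A)) = π.hom a) : ψ = π.ext := by
  ext1 M
  refine (π.extOp_unique M (ψ M) fun a x => ?_).symm
  have hl : ∀ (S T : H →L[ℂ] H) (z : H), S (T z) = (S * T) z := fun _ _ _ => rfl
  rw [← hψ, ← hψ, hl, ← map_mul, multiplier_mul_coe]

end NDRep

/-- A morphism `φ : A → M(B)` is non-degenerate if the span of `φ(A)B` is dense in `B`. -/
def NonDegenerate {A B : Type*} [NonUnitalCStarAlgebra A] [NonUnitalCStarAlgebra B]
    (φ : A →⋆ₙₐ[ℂ] 𝓜(ℂ, B)) : Prop :=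
  Dense (Submodule.span ℂ {x : B | ∃ a b, x = (φ a).fst b} : Set B)

namespace NonDegenerate

variable {A B : Type*} [NonUnitalCStarAlgebra A] [NonUnitalCStarAlgebra B]
  {φ : A →⋆ₙₐ[ℂ] 𝓜(ℂ, B)}

theorem exists_extension (h : NonDegenerate φ) (M : 𝓜(ℂ, A)) :
    ∃ T : B →L[ℂ] B, ∀ a b, T ((φ a).fst b) = (φ (M.fst a)).fst b :=
  exists_multiplier_action
    { toFun := fun a => (φ a).fst
      map_smul' := fun c a => by simp
      map_zero' := by simp
      map_add' := fun a b => by simp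
      map_mul' := fun a b => by simp }
    (fun a => by
      have := NonUnitalStarAlgHom.norm_apply_le φ a
      rw [← DoubleCentralizer.norm_fst] at this
      exact this) h M

/-- Left multiplication by `φ̃(M)` on `B`. -/
def extOp (h : NonDegenerate φ) (M : 𝓜(ℂ, A)) : B →L[ℂ] B := (h.exists_extension M).choose

theorem extOp_apply (h : NonDegenerate φ) (M : 𝓜(ℂ, A)) (a : A) (b : B) :
    h.extOp M ((φ a).fst b) = (φ (M.fst a)).fst b := (h.exists_extension M).choose_spec a b

theorem eq_of_apply_eq (h : NonDegenerate φ) {S T : B →L[ℂ] B}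
    (hST : ∀ a b, S ((φ a).fst b) = T ((φ a).fst b)) : S = T := by
  refine clm_eq_of_dense_span h ?_
  rintro _ ⟨a, y, rfl⟩
  exact hST a y

theorem extOp_unique (h : NonDegenerate φ) (M : 𝓜(ℂ, A)) (T : B →L[ℂ] B)
    (hT : ∀ a b, T ((φ a).fst b) = (φ (M.fst a)).fst b) : h.extOp M = T :=
  h.eq_of_apply_eq fun a b => by rw [extOp_apply, hT]

theorem star_extOp_mul (h : NonDegenerate φ) (M : 𝓜(ℂ, A)) (x y : B) :
    star (h.extOp M x) * y = star x * h.extOp (star M) y := by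
  have key : ∀ (a : A) (b : B) (a' : A) (b' : B),
      star (h.extOp M ((φ a).fst b)) * (φ a').fst b' =
        star ((φ a).fst b) * h.extOp (star M) ((φ a').fst b') := by
    intro a b a' b'
    have hl : ∀ (u v : 𝓜(ℂ, B)) (z : B), u.fst (v.fst z) = (u * v).fst z := fun u v z => by simp
    rw [extOp_apply, extOp_apply, star_multiplier_fst_mul, star_multiplier_fst_mul,
      ← map_star φ, ← map_star φ, hl, hl, ← map_mul φ, ← map_mul φ, star_multiplier_fst_mul]
  have h1 : ∀ (a : A) (b : B),
      ContinuousLinearMap.mul ℂ B (star (h.extOp M ((φ a).fst b))) =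
        (ContinuousLinearMap.mul ℂ B (star ((φ a).fst b))).comp (h.extOp (star M)) := by
    intro a b
    refine clm_eq_of_dense_span h ?_
    rintro _ ⟨a', b', rfl⟩
    exact key a b a' b'
  have h2 : (ContinuousLinearMap.mul ℂ B (star y)).comp (h.extOp M) =
      ContinuousLinearMap.mul ℂ B (star (h.extOp (star M) y)) := by
    refine clm_eq_of_dense_span h ?_
    rintro _ ⟨a, b, rfl⟩
    have h3 := congrArg (fun T : B →L[ℂ] B => star (T y)) (h1 a b)
    simpa using h3
  have h3 := congrArg (fun T : B →L[ℂ] B => star (T x)) h2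
  simpa using h3

/-- The double centralizer `φ̃(M)` of `B`. -/
def extMul (h : NonDegenerate φ) (M : 𝓜(ℂ, A)) : 𝓜(ℂ, B) where
  fst := h.extOp M
  snd :=
    { toFun := fun b => star (h.extOp (star M) (star b))
      map_add' := fun x y => by simp
      map_smul' := fun c x => by simp
      cont := by fun_prop }
  central := fun x y => by
    have := h.star_extOp_mul (star M) (star x) y
    rw [star_star, star_star] at this
    exact this

theorem multiplier_ext {M N : 𝓜(ℂ, B)} (hMN : M.fst = N.fst) : M = N := by
  refine DoubleCentralizer.ext ℂ B M N (Prod.ext hMN ?_)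
  ext x
  have h1 : star (M.snd x - N.snd x) = 0 := by
    refine eq_of_forall_mul_left_eq fun c => ?_
    have h2 : (M.snd x - N.snd x) * star c = 0 := by
      rw [sub_mul, M.central, N.central, hMN, sub_self]
    have h3 := congrArg star h2
    simpa using h3
  exact sub_eq_zero.mp (star_eq_zero.mp h1)

theorem extMul_unique (h : NonDegenerate φ) (M : 𝓜(ℂ, A)) (T : 𝓜(ℂ, B))
    (hT : ∀ a b, T.fst ((φ a).fst b) = (φ (M.fst a)).fst b) : h.extMul M = T :=
  multiplier_ext (h.extOp_unique M T.fst hT)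

/-- The multiplier extension `φ̃ : M(A) → M(B)` of a non-degenerate morphism `φ : A → M(B)`. -/
def ext (h : NonDegenerate φ) : 𝓜(ℂ, A) →⋆ₐ[ℂ] 𝓜(ℂ, B) where
  toFun := h.extMul
  map_one' := h.extMul_unique _ _ fun a x => rfl
  map_zero' := h.extMul_unique _ _ fun a x => by simp
  map_add' M N := h.extMul_unique _ _ fun a x => by
    simp [extMul, extOp_apply]
  map_mul' M N := h.extMul_unique _ _ fun a x => by
    simp [extMul, extOp_apply]
  commutes' r := h.extMul_unique _ _ fun a x => by
    simp [Algebra.algebraMap_eq_smul_one]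
  map_star' M := h.extMul_unique _ _ fun a x => by
    rw [DoubleCentralizer.star_fst]
    change star (star (h.extOp (star M) (star (star _)))) = _
    rw [star_star, star_star, extOp_apply]

theorem ext_apply (h : NonDegenerate φ) (M : 𝓜(ℂ, A)) (a : A) (b : B) :
    (h.ext M).fst ((φ a).fst b) = (φ (M.fst a)).fst b := h.extOp_apply M a b

/-- `φ̃` extends `φ`. -/
theorem ext_coe (h : NonDegenerate φ) (a : A) : h.ext (a : 𝓜(ℂ, A)) = φ a :=
  h.extMul_unique _ _ fun b x => by simp

/-- `φ̃` is the only extension of `φ`. -/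
theorem ext_unique (h : NonDegenerate φ) (ψ : 𝓜(ℂ, A) →⋆ₐ[ℂ] 𝓜(ℂ, B))
    (hψ : ∀ a : A, ψ (a : 𝓜(ℂ, A)) = φ a) : ψ = h.ext := by
  ext1 M
  refine (h.extMul_unique M (ψ M) fun a x => ?_).symm
  have hl : ∀ (u v : 𝓜(ℂ, B)) (z : B), u.fst (v.fst z) = (u * v).fst z := fun u v z => by simp
  rw [← hψ a, hl, ← map_mul, multiplier_mul_coe, hψ]

end NonDegenerate

/-- A unitary representation of the topological group `G` on `H`, continuous for the strong operator
topology. -/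
structure UnitaryRep (G : Type*) [Group G] [TopologicalSpace G]
    (H : Type*) [NormedAddCommGroup H] [InnerProductSpace ℂ H] [CompleteSpace H] where
  hom : G →* unitary (H →L[ℂ] H)
  continuous_apply : ∀ x : H, Continuous fun g => (hom g : H →L[ℂ] H) x

/-! ## Host algebras -/

/-- A host algebra `(L, η)` for the topological group `G`. -/
structure HostAlgebra (G L : Type u) [Group G] [TopologicalSpace G]
    [NonUnitalCStarAlgebra L] where
  η : G →* unitary 𝓜(ℂ, L)
  continuous_ext : ∀ (H : Type u) [NormedAddCommGroup H] [InnerProductSpace ℂ H] [CompleteSpace H]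
    (π : NDRep L H) (x : H), Continuous fun g => π.ext (η g : 𝓜(ℂ, L)) x
  ext_injective : ∀ (H : Type u) [NormedAddCommGroup H] [InnerProductSpace ℂ H] [CompleteSpace H]
    (π σ : NDRep L H), (∀ g, π.ext (η g : 𝓜(ℂ, L)) = σ.ext (η g : 𝓜(ℂ, L))) → π = σ

namespace HostAlgebra

variable {G L : Type u} [Group G] [TopologicalSpace G] [NonUnitalCStarAlgebra L]
  {H : Type u} [NormedAddCommGroup H] [InnerProductSpace ℂ H] [CompleteSpace H]

/-- The map `η^* : Rep(L, H) → Rep(G, H)`, `π ↦ π̃ ∘ η`. -/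
def pull (𝓛 : HostAlgebra G L) (π : NDRep L H) : UnitaryRep G H where
  hom := 
    { toFun := fun g => ⟨π.ext (𝓛.η g : 𝓜(ℂ, L)), Unitary.map_mem π.ext (𝓛.η g).2⟩
      map_one' := by ext1; simp
      map_mul' := fun g h => by ext1; simp }
  continuous_apply := 𝓛.continuous_ext H π

/-- `U` is an `L`-representation of `G`: it lies in the range of `η^*`. -/
def IsLRep (𝓛 : HostAlgebra G L) (U : UnitaryRep G H) : Prop := ∃ π : NDRep L H, 𝓛.pull π = U

/-- The representation `U_L = (η^*)⁻¹(U)` of `L` belonging to an `L`-representation `U` of `G`. -/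
def lift (𝓛 : HostAlgebra G L) {U : UnitaryRep G H} (hU : 𝓛.IsLRep U) : NDRep L H := hU.choose

theorem pull_lift (𝓛 : HostAlgebra G L) {U : UnitaryRep G H} (hU : 𝓛.IsLRep U) :
    𝓛.pull (𝓛.lift hU) = U := hU.choose_spec

end HostAlgebra

/-! ## Covariant representations -/

section Covariant

variable {G A : Type u} [Group G] [NonUnitalCStarAlgebra A]

/-- A covariant representation of `(A, G_d, α)`, with `G_d` the group `G` with the discrete
topology. -/
structure DiscreteCovRep (α : G →* (A ≃⋆ₐ[ℂ] A))
    (H : Type u) [NormedAddCommGroup H] [InnerProductSpace ℂ H] [CompleteSpace H] where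
  π : NDRep A H
  U : G →* unitary (H →L[ℂ] H)
  covariant : ∀ g a, (U g : H →L[ℂ] H) * π.hom a * star (U g : H →L[ℂ] H) = π.hom (α g a)

/-- A covariant representation `(π, U)` of `(A, G, α)`. -/
structure CovRep [TopologicalSpace G] (α : G →* (A ≃⋆ₐ[ℂ] A))
    (H : Type u) [NormedAddCommGroup H] [InnerProductSpace ℂ H] [CompleteSpace H] where
  π : NDRep A H
  U : UnitaryRep G H
  covariant : ∀ g a,
    (U.hom g : H →L[ℂ] H) * π.hom a * star (U.hom g : H →L[ℂ] H) = π.hom (α g a)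

/-- The covariant representation of `(A, G_d, α)` underlying one of `(A, G, α)`. -/
def CovRep.toDiscrete [TopologicalSpace G] {α : G →* (A ≃⋆ₐ[ℂ] A)}
    {H : Type u} [NormedAddCommGroup H] [InnerProductSpace ℂ H] [CompleteSpace H]
    (P : CovRep α H) : DiscreteCovRep α H := ⟨P.π, P.U.hom, P.covariant⟩

variable [TopologicalSpace G] {L : Type u} [NonUnitalCStarAlgebra L]

/-- The set `Rep_L(α, H)` of covariant `L`-representations on `H`. -/
def covLReps (𝓛 : HostAlgebra G L) (α : G →* (A ≃⋆ₐ[ℂ] A))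
    (H : Type u) [NormedAddCommGroup H] [InnerProductSpace ℂ H] [CompleteSpace H] :
    Set (CovRep α H) := {P | 𝓛.IsLRep P.U}

/-- The set of cross representations on `H`: those covariant `L`-representations `(π, U)` with
`π(A) U_L(L) ⊆ U_L(L) B(H)`. -/
def crossReps (𝓛 : HostAlgebra G L) (α : G →* (A ≃⋆ₐ[ℂ] A))
    (H : Type u) [NormedAddCommGroup H] [InnerProductSpace ℂ H] [CompleteSpace H] :
    Set (CovRep α H) :=
  {P | ∃ hU : 𝓛.IsLRep P.U, ∀ (a : A) (l : L), ∃ (l' : L) (T : H →L[ℂ] H),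
    P.π.hom a * (𝓛.lift hU).hom l = (𝓛.lift hU).hom l' * T}

end Covariant

/-! ## Crossed product hosts -/

/-- A crossed product host `(C, η_A, η_L)` for `(α, L)`. -/
structure CrossedProductHost {G A L : Type u} [Group G] [TopologicalSpace G]
    [NonUnitalCStarAlgebra A] [NonUnitalCStarAlgebra L] (𝓛 : HostAlgebra G L)
    (α : G →* (A ≃⋆ₐ[ℂ] A)) (C : Type u) [NonUnitalCStarAlgebra C] where
  ηA : A →⋆ₙₐ[ℂ] 𝓜(ℂ, C)
  ηL : L →⋆ₙₐ[ℂ] 𝓜(ℂ, C)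
  nondegenerate : NonDegenerate ηL
  covariant : ∀ (g : G) (a : A),
    nondegenerate.ext (𝓛.η g : 𝓜(ℂ, L)) * ηA a * star (nondegenerate.ext (𝓛.η g : 𝓜(ℂ, L))) =
      ηA (α g a)
  mul_mem : ∀ (a : A) (l : L), ∃ c : C, (c : 𝓜(ℂ, C)) = ηA a * ηL l
  generates : (NonUnitalStarAlgebra.adjoin ℂ
    {c : C | ∃ (a : A) (l : L), (c : 𝓜(ℂ, C)) = ηA a * ηL l}).topologicalClosure = ⊤

/-- The crossed product host is full: it carries every covariant `L`-representation. -/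
def CrossedProductHost.IsFull {G A L : Type u} [Group G] [TopologicalSpace G]
    [NonUnitalCStarAlgebra A] [NonUnitalCStarAlgebra L] {𝓛 : HostAlgebra G L}
    {α : G →* (A ≃⋆ₐ[ℂ] A)} {C : Type u} [NonUnitalCStarAlgebra C]
    (K : CrossedProductHost 𝓛 α C) : Prop :=
  ∀ (H : Type u) [NormedAddCommGroup H] [InnerProductSpace ℂ H] [CompleteSpace H]
    (P : CovRep α H) (hU : 𝓛.IsLRep P.U),
    ∃! ρ : C →⋆ₙₐ[ℂ] (H →L[ℂ] H), ∀ (a : A) (l : L) (c : C),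
      (c : 𝓜(ℂ, C)) = K.ηA a * K.ηL l → ρ c = P.π.hom a * (𝓛.lift hU).hom l

/-! ## Hilbert direct sums of operators and representations -/

section DirectSum

variable {ι : Type*} {H : ι → Type*} [∀ i, NormedAddCommGroup (H i)]
  [∀ i, InnerProductSpace ℂ (H i)]

theorem memℓp_diag (T : ∀ i, H i →L[ℂ] H i) {C : ℝ} (hT : ∀ i, ‖T i‖ ≤ C) (x : lp H 2) :
    Memℓp (fun i => T i (x i)) 2 := by
  have h1 : Memℓp (fun i => C * ‖x i‖) 2 :=
    (memℓp_norm_iff.mpr (lp.memℓp x)).const_mul C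
  refine h1.mono fun i => ?_
  exact ((T i).le_opNorm _).trans (mul_le_mul_of_nonneg_right (hT i) (norm_nonneg _))

/-- The direct sum `⊕ T_i` of a bounded family of operators. -/
def diagOp (T : ∀ i, H i →L[ℂ] H i) (hT : ∃ C, ∀ i, ‖T i‖ ≤ C) : lp H 2 →L[ℂ] lp H 2 :=
  LinearMap.mkContinuousOfExistsBound
    { toFun := fun x => ⟨fun i => T i (x i), memℓp_diag T hT.choose_spec x⟩
      map_add' := fun x y => by ext i; exact map_add (T i) (x i) (y i)
      map_smul' := fun c x => by ext i; exact map_smul (T i) c (x i) }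
    (by
      obtain ⟨C, hC⟩ := hT
      refine ⟨|C|, fun x => ?_⟩
      have h2 : (0 : ℝ) < (2 : ℝ≥0∞).toReal := by norm_num
      refine lp.norm_le_of_forall_sum_le h2 (by positivity) fun s => ?_
      calc ∑ i ∈ s, ‖T i (x i)‖ ^ (2 : ℝ≥0∞).toReal
          ≤ ∑ i ∈ s, |C| ^ (2 : ℝ≥0∞).toReal * ‖x i‖ ^ (2 : ℝ≥0∞).toReal := by
            refine Finset.sum_le_sum fun i _ => ?_
            rw [← Real.mul_rpow (abs_nonneg C) (norm_nonneg _)]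
            refine Real.rpow_le_rpow (norm_nonneg _) ?_ h2.le
            exact ((T i).le_opNorm _).trans
              (mul_le_mul_of_nonneg_right ((hC i).trans (le_abs_self C)) (norm_nonneg _))
        _ = |C| ^ (2 : ℝ≥0∞).toReal * ∑ i ∈ s, ‖x i‖ ^ (2 : ℝ≥0∞).toReal := by
            rw [Finset.mul_sum]
        _ ≤ |C| ^ (2 : ℝ≥0∞).toReal * ‖x‖ ^ (2 : ℝ≥0∞).toReal := by
            gcongr
            exact lp.sum_rpow_le_norm_rpow h2 x s
        _ = (|C| * ‖x‖) ^ (2 : ℝ≥0∞).toReal := by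
            rw [Real.mul_rpow (abs_nonneg C) (norm_nonneg _)])

@[simp]
theorem diagOp_apply (T : ∀ i, H i →L[ℂ] H i) (hT : ∃ C, ∀ i, ‖T i‖ ≤ C) (x : lp H 2) (i : ι) :
    diagOp T hT x i = T i (x i) := rfl

theorem diagOp_single [DecidableEq ι] (T : ∀ i, H i →L[ℂ] H i) (hT : ∃ C, ∀ i, ‖T i‖ ≤ C)
    (i : ι) (x : H i) : diagOp T hT (lp.single 2 i x) = lp.single 2 i (T i x) := by
  ext j
  rw [diagOp_apply]
  by_cases h : j = i
  · subst h
    simp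
  · rw [lp.single_apply_ne _ _ _ h, lp.single_apply_ne _ _ _ h, map_zero]

theorem dense_of_single_mem [DecidableEq ι] (S : Submodule ℂ (lp H 2))
    (h : ∀ i x, lp.single 2 i x ∈ S.topologicalClosure) : Dense (S : Set (lp H 2)) := by
  intro x
  have h1 := lp.hasSum_single (by norm_num : (2 : ℝ≥0∞) ≠ ⊤) x
  exact S.isClosed_topologicalClosure.mem_of_tendsto h1
    (Eventually.of_forall fun s => S.topologicalClosure.sum_mem fun i _ => h i _)

variable [∀ i, CompleteSpace (H i)]

theorem diagOp_star (T : ∀ i, H i →L[ℂ] H i) (hT : ∃ C, ∀ i, ‖T i‖ ≤ C)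
    (hT' : ∃ C, ∀ i, ‖star (T i)‖ ≤ C) :
    diagOp (fun i => star (T i)) hT' = star (diagOp T hT) := by
  rw [ContinuousLinearMap.star_eq_adjoint, ContinuousLinearMap.eq_adjoint_iff]
  intro x y
  rw [lp.inner_eq_tsum, lp.inner_eq_tsum]
  refine tsum_congr fun i => ?_
  rw [diagOp_apply, diagOp_apply, ContinuousLinearMap.star_eq_adjoint,
    ContinuousLinearMap.adjoint_inner_left]

variable {A : Type*} [NonUnitalCStarAlgebra A]

/-- The direct sum `⊕ π_i` of non-degenerate representations. -/
def NDRep.directSum (π : ∀ i, NDRep A (H i)) : NDRep A (lp H 2) where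
  hom :=
    { toFun := fun a => diagOp (fun i => (π i).hom a)
        ⟨‖a‖, fun i => NonUnitalStarAlgHom.norm_apply_le (π i).hom a⟩
      map_smul' := fun c a => by ext x i; simp
      map_zero' := by ext x i; simp
      map_add' := fun a b => by ext x i; simp
      map_mul' := fun a b => by ext x i; simp
      map_star' := fun a => by
        rw [← diagOp_star]
        · simp only [map_star]
        · exact ⟨‖a‖, fun i => by
            rw [norm_star]
            exact NonUnitalStarAlgHom.norm_apply_le (π i).hom a⟩ }
  nondegenerate := by
    classical
    refine dense_of_single_mem _ fun i x => ?_
    have hx := (π i).nondegenerate x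
    have hc : Continuous (lp.single (E := H) 2 i) := (lp.isometry_single i).continuous
    refine map_mem_closure hc hx fun y hy => ?_
    induction hy using Submodule.span_induction with
    | mem y hy =>
      obtain ⟨a, z, rfl⟩ := hy
      refine Submodule.subset_span ⟨a, lp.single 2 i z, ?_⟩
      exact (diagOp_single (fun i => (π i).hom a)
        ⟨‖a‖, fun i => NonUnitalStarAlgHom.norm_apply_le (π i).hom a⟩ i z).symm
    | zero =>
      rw [lp.single_zero]
      exact Submodule.zero_mem _
    | add y z _ _ h1 h2 =>
      rw [lp.single_add]
      exact Submodule.add_mem _ h1 h2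
    | smul c y _ h1 =>
      rw [lp.single_smul]
      exact Submodule.smul_mem _ c h1

@[simp]
theorem NDRep.directSum_apply (π : ∀ i, NDRep A (H i)) (a : A) (x : lp H 2) (i : ι) :
    (NDRep.directSum π).hom a x i = (π i).hom a (x i) := rfl

theorem unitary_norm_le {K : Type*} [NormedAddCommGroup K] [InnerProductSpace ℂ K]
    [CompleteSpace K] (u : unitary (K →L[ℂ] K)) : ‖(u : K →L[ℂ] K)‖ ≤ 1 :=
  by
  refine ContinuousLinearMap.opNorm_le_bound _ zero_le_one fun x => ?_
  rw [one_mul]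
  exact (ContinuousLinearMap.norm_map_of_mem_unitary u.2 x).le

variable {G : Type*} [Group G]

/-- The direct sum `⊕ U_i` of unitary representations of the abstract group `G`. -/
def unitaryDirectSum (U : ∀ i, G →* unitary (H i →L[ℂ] H i)) :
    G →* unitary (lp H 2 →L[ℂ] lp H 2) where
  toFun g := ⟨diagOp (fun i => (U i g : H i →L[ℂ] H i)) ⟨1, fun i => unitary_norm_le _⟩, by
    have hs : star (diagOp (fun i => (U i g : H i →L[ℂ] H i)) ⟨1, fun i => unitary_norm_le _⟩) =
        diagOp (fun i => star (U i g : H i →L[ℂ] H i))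
          ⟨1, fun i => by rw [norm_star]; exact unitary_norm_le _⟩ := (diagOp_star _ _ _).symm
    rw [Unitary.mem_iff, hs]
    constructor
    · ext x i
      have := congrArg (fun T : H i →L[ℂ] H i => T (x i)) (Unitary.coe_star_mul_self (U i g))
      exact this
    · ext x i
      have := congrArg (fun T : H i →L[ℂ] H i => T (x i)) (Unitary.coe_mul_star_self (U i g))
      exact this⟩
  map_one' := by
    ext x i
    simp
  map_mul' g h := by
    ext x i
    simp

@[simp]
theorem unitaryDirectSum_apply (U : ∀ i, G →* unitary (H i →L[ℂ] H i)) (g : G) (x : lp H 2)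
    (i : ι) : (unitaryDirectSum U g : lp H 2 →L[ℂ] lp H 2) x i =
      (U i g : H i →L[ℂ] H i) (x i) := rfl

variable [TopologicalSpace G]

/-- The direct sum of continuous unitary representations. -/
def UnitaryRep.directSum (U : ∀ i, UnitaryRep G (H i)) : UnitaryRep G (lp H 2) where
  hom := unitaryDirectSum fun i => (U i).hom
  continuous_apply := by
    classical
    let V := unitaryDirectSum fun i => (U i).hom
    -- the set of vectors with continuous orbit map is a closed subspace
    let S : Submodule ℂ (lp H 2) :=
      { carrier := {x | Continuous fun g => (V g : lp H 2 →L[ℂ] lp H 2) x}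
        add_mem' := fun {x y} hx hy => by
          have : Continuous fun g => (V g : lp H 2 →L[ℂ] lp H 2) x +
            (V g : lp H 2 →L[ℂ] lp H 2) y := Continuous.add hx hy
          simpa only [Set.mem_ofPred_eq, map_add] using this
        zero_mem' := by
          simp only [Set.mem_ofPred_eq, map_zero]
          exact continuous_const
        smul_mem' := fun c x hx => by
          have : Continuous fun g => c • (V g : lp H 2 →L[ℂ] lp H 2) x := Continuous.const_smul hx c
          simpa only [Set.mem_ofPred_eq, map_smul] using this }
    have hS : IsClosed (S : Set (lp H 2)) := by
      refine isClosed_of_closure_subset fun x hx => ?_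
      change Continuous fun g => (V g : lp H 2 →L[ℂ] lp H 2) x
      refine continuous_of_uniform_approx_of_continuous fun u hu => ?_
      obtain ⟨ε, hε, hu⟩ := Metric.mem_uniformity_dist.mp hu
      obtain ⟨y, hy, hxy⟩ := Metric.mem_closure_iff.mp hx ε hε
      refine ⟨fun g => (V g : lp H 2 →L[ℂ] lp H 2) y, hy, fun g => hu ?_⟩
      rw [dist_eq_norm, ← map_sub]
      calc ‖(V g : lp H 2 →L[ℂ] lp H 2) (x - y)‖
          ≤ ‖(V g : lp H 2 →L[ℂ] lp H 2)‖ * ‖x - y‖ := ContinuousLinearMap.le_opNorm _ _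
        _ ≤ 1 * ‖x - y‖ := by gcongr; exact unitary_norm_le _
        _ < ε := by rw [one_mul, ← dist_eq_norm]; exact hxy
    have hd : Dense (S : Set (lp H 2)) := by
      refine dense_of_single_mem S fun i x => S.le_topologicalClosure ?_
      change Continuous fun g => (V g : lp H 2 →L[ℂ] lp H 2) (lp.single 2 i x)
      have h1 : ∀ g, (V g : lp H 2 →L[ℂ] lp H 2) (lp.single 2 i x) =
          lp.single 2 i (((U i).hom g : H i →L[ℂ] H i) x) := fun g =>
        diagOp_single (fun i => ((U i).hom g : H i →L[ℂ] H i)) ⟨1, fun i => unitary_norm_le _⟩ i x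
      simp only [h1]
      exact (lp.isometry_single i).continuous.comp ((U i).continuous_apply x)
    intro x
    have : x ∈ (S : Set (lp H 2)) := by
      rw [← hS.closure_eq]
      exact hd x
    exact this

end DirectSum

section UniverseU

variable {ι : Type u} {H : ι → Type u} [∀ i, NormedAddCommGroup (H i)]
  [∀ i, InnerProductSpace ℂ (H i)] [∀ i, CompleteSpace (H i)]
  {G A : Type u} [Group G] [TopologicalSpace G] [NonUnitalCStarAlgebra A]

/-- The direct sum of covariant representations. -/
def CovRep.directSum {α : G →* (A ≃⋆ₐ[ℂ] A)} (P : ∀ i, CovRep α (H i)) : CovRep α (lp H 2) where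
  π := NDRep.directSum fun i => (P i).π
  U := UnitaryRep.directSum fun i => (P i).U
  covariant g a := by
    have hs : star ((UnitaryRep.directSum fun i => (P i).U).hom g : lp H 2 →L[ℂ] lp H 2) =
        diagOp (fun i => star ((P i).U.hom g : H i →L[ℂ] H i))
          ⟨1, fun i => by rw [norm_star]; exact unitary_norm_le _⟩ :=
      (diagOp_star (fun i => ((P i).U.hom g : H i →L[ℂ] H i)) ⟨1, fun i => unitary_norm_le _⟩
        ⟨1, fun i => by rw [norm_star]; exact unitary_norm_le _⟩).symm
    rw [hs]
    refine ContinuousLinearMap.ext fun x => lp.ext (funext fun i => ?_)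
    exact congrArg (fun T : H i →L[ℂ] H i => T (x i)) ((P i).covariant g a)

/-- A direct sum of `L`-representations is an `L`-representation. -/
theorem HostAlgebra.isLRep_directSum {L : Type u} [NonUnitalCStarAlgebra L] (𝓛 : HostAlgebra G L)
    (U : ∀ i, UnitaryRep G (H i)) (hU : ∀ i, 𝓛.IsLRep (U i)) :
    𝓛.IsLRep (UnitaryRep.directSum U) := by
  choose σ hσ using hU
  refine ⟨NDRep.directSum σ, ?_⟩
  have h1 : (𝓛.pull (NDRep.directSum σ)).hom = (UnitaryRep.directSum U).hom := by
    refine MonoidHom.ext fun g => Subtype.ext ?_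
    refine (NDRep.directSum σ).eq_of_apply_eq fun a x => ?_
    refine ((NDRep.directSum σ).ext_apply _ a x).trans (lp.ext (funext fun i => ?_))
    refine ((σ i).ext_apply (𝓛.η g : 𝓜(ℂ, L)) a (x i)).symm.trans ?_
    exact congrArg (fun V : UnitaryRep G (H i) => (V.hom g : H i →L[ℂ] H i) ((σ i).hom a (x i)))
      (hσ i)
  rcases hp : 𝓛.pull (NDRep.directSum σ) with ⟨V, hV⟩
  rcases hq : UnitaryRep.directSum U with ⟨W, hW⟩
  rw [hp, hq] at h1
  subst h1
  rfl

end UniverseU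

/-! ## The crossed product `A ⋊ G_d` -/

/-- The covariance algebra of `(A, G_d, α)`: finitely supported functions `G → A`, with
`a δ_g` the function `single g a`. -/
def CovAlg {G A : Type u} [Group G] [NonUnitalCStarAlgebra A] (_α : G →* (A ≃⋆ₐ[ℂ] A)) : Type u :=
  G →₀ A

namespace CovAlg

variable {G A : Type u} [Group G] [NonUnitalCStarAlgebra A] {α : G →* (A ≃⋆ₐ[ℂ] A)}

instance : AddCommGroup (CovAlg α) := inferInstanceAs (AddCommGroup (G →₀ A))

instance : Module ℂ (CovAlg α) := inferInstanceAs (Module ℂ (G →₀ A))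

/-- The element `a δ_g`. -/
def of (α : G →* (A ≃⋆ₐ[ℂ] A)) (g : G) : A →ₗ[ℂ] CovAlg α := Finsupp.lsingle g

/-- The linear map on the covariance algebra with prescribed values on the elements `a δ_g`. -/
def lift {W : Type*} [AddCommGroup W] [Module ℂ W] (F : G → A →ₗ[ℂ] W) : CovAlg α →ₗ[ℂ] W :=
  Finsupp.lsum ℂ F

@[simp]
theorem lift_of {W : Type*} [AddCommGroup W] [Module ℂ W] (F : G → A →ₗ[ℂ] W) (g : G) (a : A) :
    lift F (of α g a) = F g a :=
  Finsupp.lsum_single ℂ F g a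

@[elab_as_elim]
theorem induction {p : CovAlg α → Prop} (f : CovAlg α) (zero : p 0)
    (add : ∀ f h, p f → p h → p (f + h)) (single : ∀ g a, p (of α g a)) : p f :=
  Finsupp.induction_linear f zero add single

/-- The action `α_g` as a linear map. -/
def act (α : G →* (A ≃⋆ₐ[ℂ] A)) (g : G) : A →ₗ[ℂ] A where
  toFun := α g
  map_add' := map_add (α g)
  map_smul' := map_smul (α g)

@[simp]
theorem act_apply (g : G) (a : A) : act α g a = α g a := rfl

/-- The convolution product as a bilinear map, `(a δ_s)(b δ_t) = a α_s(b) δ_{st}`. -/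
def mulBilin (α : G →* (A ≃⋆ₐ[ℂ] A)) : CovAlg α →ₗ[ℂ] CovAlg α →ₗ[ℂ] CovAlg α :=
  lift fun s =>
    { toFun := fun a => lift fun t => of α (s * t) ∘ₗ LinearMap.mulLeft ℂ a ∘ₗ act α s
      map_add' := fun a b => by
        ext f
        induction f using CovAlg.induction with
        | zero => simp
        | add f h hf hh => simp only [map_add, hf, hh]
        | single t c => simp [add_mul]
      map_smul' := fun z a => by
        ext f
        induction f using CovAlg.induction with
        | zero => simp
        | add f h hf hh => simp only [map_add, hf, hh]
        | single t c => simp [smul_mul_assoc] }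

instance : Mul (CovAlg α) := ⟨fun f h => mulBilin α f h⟩

theorem mul_def (f h : CovAlg α) : f * h = mulBilin α f h := rfl

@[simp]
theorem of_mul_of (s t : G) (a b : A) : of α s a * of α t b = of α (s * t) (a * α s b) := by
  simp [mul_def, mulBilin]

instance : NonUnitalNonAssocRing (CovAlg α) where
  left_distrib f h k := by simp [mul_def]
  right_distrib f h k := by simp [mul_def]
  zero_mul f := by simp [mul_def]
  mul_zero f := by simp [mul_def]

instance : NonUnitalRing (CovAlg α) where
  mul_assoc f h k := by
    induction f using CovAlg.induction with
    | zero => simp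
    | add f f' hf hf' => simp only [add_mul, hf, hf']
    | single s a =>
      induction h using CovAlg.induction with
      | zero => simp
      | add h h' hh hh' => simp only [add_mul, mul_add, hh, hh']
      | single t b =>
        induction k using CovAlg.induction with
        | zero => simp
        | add k k' hk hk' => simp only [mul_add, hk, hk']
        | single r c => simp [mul_assoc]

instance : IsScalarTower ℂ (CovAlg α) (CovAlg α) where
  smul_assoc z f h := by simp [mul_def]

instance : SMulCommClass ℂ (CovAlg α) (CovAlg α) where
  smul_comm z f h := by simp [mul_def]

/-- The involution, `(a δ_s)^* = α_{s⁻¹}(a^*) δ_{s⁻¹}`. -/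
def starHom (α : G →* (A ≃⋆ₐ[ℂ] A)) : CovAlg α →+ CovAlg α :=
  Finsupp.liftAddHom fun s =>
    ((of α s⁻¹).toAddMonoidHom.comp (act α s⁻¹).toAddMonoidHom).comp (starAddEquiv : A ≃+ A)

instance : Star (CovAlg α) := ⟨fun f => starHom α f⟩

theorem star_def (f : CovAlg α) : star f = starHom α f := rfl

@[simp]
theorem star_of (s : G) (a : A) : star (of α s a) = of α s⁻¹ (α s⁻¹ (star a)) := by
  rw [star_def, starHom]
  exact Finsupp.liftAddHom_apply_single _ s a

theorem star_zero' : star (0 : CovAlg α) = 0 := by simp [star_def]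

theorem star_add' (f h : CovAlg α) : star (f + h) = star f + star h := by simp [star_def]

instance : StarRing (CovAlg α) where
  star_involutive f := by
    induction f using CovAlg.induction with
    | zero => simp only [star_zero']
    | add f h hf hh => simp only [star_add', hf, hh]
    | single s a => simp [← map_star, ← StarAlgEquiv.mul_apply]
  star_mul f h := by
    induction f using CovAlg.induction with
    | zero => simp only [star_zero', zero_mul, mul_zero]
    | add f f' hf hf' => simp only [add_mul, mul_add, star_add', hf, hf']
    | single s a =>
      induction h using CovAlg.induction with
      | zero => simp only [star_zero', zero_mul, mul_zero]
      | add h h' hh hh' => simp only [add_mul, mul_add, star_add', hh, hh']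
      | single t b =>
        have h1 : ∀ c : A, α t⁻¹ (α s⁻¹ c) = α (t⁻¹ * s⁻¹) c := fun c => by
          rw [map_mul, StarAlgEquiv.mul_apply]
        have h2 : α (t⁻¹ * s⁻¹) (α s (star b)) = α t⁻¹ (star b) := by
          rw [← StarAlgEquiv.mul_apply, ← map_mul, inv_mul_cancel_right]
        rw [of_mul_of, star_of, star_of, star_of, of_mul_of, star_mul, mul_inv_rev, map_mul, h1,
          ← map_star (α s), h2]
  star_add := star_add'

instance : StarModule ℂ (CovAlg α) where
  star_smul z f := by
    induction f using CovAlg.induction with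
    | zero => simp
    | add f h hf hh => simp only [smul_add, star_add, hf, hh]
    | single s a => simp only [← map_smul, star_of, star_smul]

end CovAlg

namespace DiscreteCovRep

variable {G A : Type u} [Group G] [NonUnitalCStarAlgebra A] {α : G →* (A ≃⋆ₐ[ℂ] A)}
  {H : Type u} [NormedAddCommGroup H] [InnerProductSpace ℂ H] [CompleteSpace H]

theorem U_mul_π (P : DiscreteCovRep α H) (g : G) (a : A) :
    (P.U g : H →L[ℂ] H) * P.π.hom a = P.π.hom (α g a) * (P.U g : H →L[ℂ] H) := by
  rw [← P.covariant, mul_assoc, Unitary.coe_star_mul_self, mul_one]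

/-- The integrated form of a covariant representation as a linear map,
`a δ_g ↦ π(a) U(g)`. -/
def integrateLin (P : DiscreteCovRep α H) : CovAlg α →ₗ[ℂ] (H →L[ℂ] H) :=
  CovAlg.lift fun g =>
    { toFun := fun a => P.π.hom a * (P.U g : H →L[ℂ] H)
      map_add' := fun a b => by rw [map_add, add_mul]
      map_smul' := fun z a => by rw [map_smul, smul_mul_assoc, RingHom.id_apply] }

@[simp]
theorem integrateLin_of (P : DiscreteCovRep α H) (g : G) (a : A) :
    P.integrateLin (CovAlg.of α g a) = P.π.hom a * (P.U g : H →L[ℂ] H) := by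
  simp [integrateLin]

/-- The integrated form `π ⋊ U` on the covariance algebra, `a δ_g ↦ π(a) U(g)`. -/
def integrate (P : DiscreteCovRep α H) : CovAlg α →⋆ₙₐ[ℂ] (H →L[ℂ] H) where
  toFun := P.integrateLin
  map_smul' := map_smul P.integrateLin
  map_zero' := map_zero P.integrateLin
  map_add' := map_add P.integrateLin
  map_mul' f h := by
    induction f using CovAlg.induction with
    | zero => simp
    | add f f' hf hf' => simp only [add_mul, map_add, hf, hf']
    | single s a =>
      induction h using CovAlg.induction with
      | zero => simp
      | add h h' hh hh' => simp only [mul_add, map_add, hh, hh']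
      | single t b =>
        simp only [CovAlg.of_mul_of, integrateLin_of, map_mul, Submonoid.coe_mul]
        rw [mul_assoc, mul_assoc, ← mul_assoc (P.U s : H →L[ℂ] H), U_mul_π, mul_assoc]
  map_star' f := by
    induction f using CovAlg.induction with
    | zero => simp
    | add f f' hf hf' => simp only [star_add, map_add, hf, hf']
    | single s a =>
      simp only [CovAlg.star_of, integrateLin_of, star_mul, ← U_mul_π]
      simp only [map_inv, map_star]
      rfl

@[simp]
theorem integrate_of (P : DiscreteCovRep α H) (g : G) (a : A) :
    P.integrate (CovAlg.of α g a) = P.π.hom a * (P.U g : H →L[ℂ] H) := P.integrateLin_of g a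

theorem norm_integrate_le (P : DiscreteCovRep α H) (f : CovAlg α) :
    ‖P.integrate f‖ ≤ Finsupp.sum f fun _ a => ‖a‖ := by
  have h1 : P.integrate f = Finsupp.sum f fun g a => P.π.hom a * (P.U g : H →L[ℂ] H) := rfl
  rw [h1]
  refine (norm_sum_le _ _).trans (Finset.sum_le_sum fun g _ => ?_)
  refine (norm_mul_le _ _).trans ?_
  calc _ ≤ ‖P.π.hom (f.toFun g)‖ * 1 :=
        mul_le_mul_of_nonneg_left (unitary_norm_le _) (norm_nonneg _)
    _ ≤ _ := by
        rw [mul_one]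
        exact NonUnitalStarAlgHom.norm_apply_le P.π.hom _

end DiscreteCovRep

namespace CovAlg

variable {G A : Type u} [Group G] [NonUnitalCStarAlgebra A] {α : G →* (A ≃⋆ₐ[ℂ] A)}

/-- The values `‖(π ⋊ U)(f)‖`, for all covariant representations `(π, U)` of `(A, G_d, α)`. -/
def normSet (f : CovAlg α) : Set ℝ :=
  {r | ∃ (H : Type u) (_ : NormedAddCommGroup H) (_ : InnerProductSpace ℂ H)
    (_ : CompleteSpace H) (P : DiscreteCovRep α H), r = ‖P.integrate f‖}

/-- The universal `C⋆`-seminorm: `‖f‖ = sup ‖(π ⋊ U)(f)‖` over all covariant representations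
`(π, U)` of `(A, G_d, α)`. -/
instance : Norm (CovAlg α) := ⟨fun f => sSup f.normSet⟩

theorem norm_def (f : CovAlg α) : ‖f‖ = sSup f.normSet := rfl

theorem norm_integrate_le {H : Type u} [NormedAddCommGroup H] [InnerProductSpace ℂ H]
    [CompleteSpace H] (P : DiscreteCovRep α H) (f : CovAlg α) : ‖P.integrate f‖ ≤ ‖f‖ := by
  refine le_csSup ⟨Finsupp.sum f fun _ a => ‖a‖, ?_⟩ ⟨H, _, _, _, P, rfl⟩
  rintro _ ⟨K, _, _, _, Q, rfl⟩
  exact Q.norm_integrate_le f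

theorem norm_nonneg' (f : CovAlg α) : 0 ≤ ‖f‖ := by
  refine Real.sSup_nonneg ?_
  rintro _ ⟨K, _, _, _, Q, rfl⟩
  exact norm_nonneg _

theorem norm_le_of_forall {f : CovAlg α} {C : ℝ} (hC : 0 ≤ C)
    (h : ∀ (H : Type u) [NormedAddCommGroup H] [InnerProductSpace ℂ H] [CompleteSpace H]
      (P : DiscreteCovRep α H), ‖P.integrate f‖ ≤ C) : ‖f‖ ≤ C := by
  refine Real.sSup_le ?_ hC
  rintro _ ⟨K, _, _, _, Q, rfl⟩
  exact h K Q

/-- The universal `C⋆`-seminorm, bundled. -/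
def groupSeminorm (α : G →* (A ≃⋆ₐ[ℂ] A)) : AddGroupSeminorm (CovAlg α) where
  toFun f := ‖f‖
  map_zero' := le_antisymm (norm_le_of_forall le_rfl fun H _ _ _ P => by simp) (norm_nonneg' _)
  add_le' f h := norm_le_of_forall (add_nonneg (norm_nonneg' f) (norm_nonneg' h))
    fun H _ _ _ P => by
      rw [map_add]
      exact (norm_add_le _ _).trans (add_le_add (norm_integrate_le P f) (norm_integrate_le P h))
  neg' f := by
    simp only [norm_def, normSet, map_neg, norm_neg]

instance : NonUnitalSeminormedRing (CovAlg α) where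
  __ := (groupSeminorm α).toSeminormedAddCommGroup
  __ := (inferInstance : NonUnitalRing (CovAlg α))
  norm_mul_le f h := norm_le_of_forall (mul_nonneg (norm_nonneg' f) (norm_nonneg' h))
    fun H _ _ _ P => by
      rw [map_mul]
      exact (norm_mul_le _ _).trans (mul_le_mul (norm_integrate_le P f) (norm_integrate_le P h)
        (norm_nonneg _) (norm_nonneg' f))

instance : NormedSpace ℂ (CovAlg α) where
  norm_smul_le z f := norm_le_of_forall (mul_nonneg (norm_nonneg z) (norm_nonneg' f))
    fun H _ _ _ P => by
      rw [map_smul, norm_smul]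
      exact mul_le_mul_of_nonneg_left (norm_integrate_le P f) (norm_nonneg z)

instance : NormedStarGroup (CovAlg α) where
  norm_star_le f := norm_le_of_forall (norm_nonneg' f) fun H _ _ _ P => by
    rw [map_star, norm_star]
    exact norm_integrate_le P f

theorem norm_mul_self_le (f : CovAlg α) : ‖f‖ * ‖f‖ ≤ ‖star f * f‖ := by
  have h1 : ‖f‖ ≤ √‖star f * f‖ := norm_le_of_forall (Real.sqrt_nonneg _) fun H _ _ _ P => by
    refine Real.le_sqrt_of_sq_le ?_
    rw [sq, ← CStarRing.norm_star_mul_self, ← map_star, ← map_mul]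
    exact norm_integrate_le P _
  calc ‖f‖ * ‖f‖ ≤ √‖star f * f‖ * √‖star f * f‖ :=
        mul_le_mul h1 h1 (norm_nonneg _) (Real.sqrt_nonneg _)
    _ = _ := Real.mul_self_sqrt (norm_nonneg _)

end CovAlg

/-- The `C⋆`-algebra `A ⋊_α G_d`: the (Hausdorff) completion of the covariance algebra in the
universal `C⋆`-seminorm. -/
def CrossedProduct {G A : Type u} [Group G] [NonUnitalCStarAlgebra A]
    (α : G →* (A ≃⋆ₐ[ℂ] A)) : Type u := UniformSpace.Completion (CovAlg α)

namespace CrossedProduct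

open UniformSpace UniformSpace.Completion

variable {G A : Type u} [Group G] [NonUnitalCStarAlgebra A] {α : G →* (A ≃⋆ₐ[ℂ] A)}

instance : NormedAddCommGroup (CrossedProduct α) :=
  inferInstanceAs (NormedAddCommGroup (Completion (CovAlg α)))

instance : NormedSpace ℂ (CrossedProduct α) :=
  inferInstanceAs (NormedSpace ℂ (Completion (CovAlg α)))

instance : CompleteSpace (CrossedProduct α) :=
  inferInstanceAs (CompleteSpace (Completion (CovAlg α)))

/-- The canonical map of the covariance algebra into the crossed product. -/
def incl (α : G →* (A ≃⋆ₐ[ℂ] A)) : CovAlg α →L[ℂ] CrossedProduct α :=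
  (toComplL : CovAlg α →L[ℂ] Completion (CovAlg α))

theorem norm_incl (f : CovAlg α) : ‖incl α f‖ = ‖f‖ := Completion.norm_coe f

theorem denseRange_incl : DenseRange (incl α) := denseRange_coe

theorem isUniformInducing_incl : IsUniformInducing (incl α) :=
  (AddMonoidHomClass.isometry_of_norm (incl α) norm_incl).isUniformInducing

@[elab_as_elim]
theorem dense_induction {p : CrossedProduct α → Prop} (x : CrossedProduct α)
    (hp : IsClosed {x | p x}) (h : ∀ f, p (incl α f)) : p x :=
  denseRange_incl.induction_on x hp h

/-- The product of the covariance algebra, with values in the crossed product. -/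
def mulBilin₀ (α : G →* (A ≃⋆ₐ[ℂ] A)) : CovAlg α →L[ℂ] CovAlg α →L[ℂ] CrossedProduct α :=
  (ContinuousLinearMap.compL ℂ (CovAlg α) (CovAlg α) (CrossedProduct α) (incl α)).comp
    (ContinuousLinearMap.mul ℂ (CovAlg α))

/-- The product of the crossed product: the continuous extension of that of the covariance
algebra. -/
def mulBilin (α : G →* (A ≃⋆ₐ[ℂ] A)) :
    CrossedProduct α →L[ℂ] CrossedProduct α →L[ℂ] CrossedProduct α :=
  (((mulBilin₀ α).extend (incl α)).flip.extend (incl α)).flip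

instance : Mul (CrossedProduct α) := ⟨fun x y => mulBilin α x y⟩

theorem mul_def (x y : CrossedProduct α) : x * y = mulBilin α x y := rfl

theorem incl_mul (f h : CovAlg α) : incl α (f * h) = incl α f * incl α h := by
  rw [mul_def, mulBilin, ContinuousLinearMap.flip_apply,
    ContinuousLinearMap.extend_eq _ denseRange_incl isUniformInducing_incl,
    ContinuousLinearMap.flip_apply,
    ContinuousLinearMap.extend_eq _ denseRange_incl isUniformInducing_incl]
  rfl

theorem continuous_mul' : Continuous fun p : CrossedProduct α × CrossedProduct α => p.1 * p.2 := by
  simp only [mul_def]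
  fun_prop

instance : ContinuousMul (CrossedProduct α) := ⟨continuous_mul'⟩

instance : NonUnitalNonAssocRing (CrossedProduct α) where
  left_distrib x y z := by simp only [mul_def, map_add]
  right_distrib x y z := by simp only [mul_def, map_add, add_apply]
  zero_mul x := by simp only [mul_def, map_zero, zero_apply]
  mul_zero x := by simp only [mul_def, map_zero]

instance : NonUnitalNormedRing (CrossedProduct α) where
  __ := (inferInstance : NormedAddCommGroup (CrossedProduct α))
  __ := (inferInstance : NonUnitalNonAssocRing (CrossedProduct α))
  mul_assoc x y z := by
    induction x using dense_induction with
    | hp => exact isClosed_eq (by fun_prop) (by fun_prop)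
    | h f =>
      induction y using dense_induction with
      | hp => exact isClosed_eq (by fun_prop) (by fun_prop)
      | h k =>
        induction z using dense_induction with
        | hp => exact isClosed_eq (by fun_prop) (by fun_prop)
        | h l => simp only [← incl_mul, mul_assoc]
  norm_mul_le x y := by
    induction x using dense_induction with
    | hp => exact isClosed_le (by fun_prop) (by fun_prop)
    | h f =>
      induction y using dense_induction with
      | hp => exact isClosed_le (by fun_prop) (by fun_prop)
      | h k =>
        rw [← incl_mul, norm_incl, norm_incl, norm_incl]
        exact norm_mul_le f k

instance : IsScalarTower ℂ (CrossedProduct α) (CrossedProduct α) where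
  smul_assoc z x y := by
    simp only [smul_eq_mul, mul_def, map_smul, smul_apply]

instance : SMulCommClass ℂ (CrossedProduct α) (CrossedProduct α) where
  smul_comm z x y := by simp only [smul_eq_mul, mul_def, map_smul]

theorem uniformContinuous_star_covAlg : UniformContinuous (star : CovAlg α → CovAlg α) :=
  (AddMonoidHomClass.isometry_of_norm (starAddEquiv : CovAlg α ≃+ CovAlg α)
    (fun f => norm_star f)).uniformContinuous

/-- The involution of the crossed product: the continuous extension of that of the covariance
algebra. -/
instance : Star (CrossedProduct α) :=
  ⟨Completion.map (star : CovAlg α → CovAlg α)⟩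

theorem incl_star (f : CovAlg α) : incl α (star f) = star (incl α f) :=
  (Completion.map_coe uniformContinuous_star_covAlg f).symm

theorem continuous_star' : Continuous (star : CrossedProduct α → CrossedProduct α) :=
  Completion.continuous_map

instance : ContinuousStar (CrossedProduct α) := ⟨continuous_star'⟩

instance : StarRing (CrossedProduct α) where
  star_involutive x := by
    induction x using dense_induction with
    | hp => exact isClosed_eq (by fun_prop) (by fun_prop)
    | h f => rw [← incl_star, ← incl_star, star_star]
  star_mul x y := by
    induction x using dense_induction with
    | hp => exact isClosed_eq (by fun_prop) (by fun_prop)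
    | h f =>
      induction y using dense_induction with
      | hp => exact isClosed_eq (by fun_prop) (by fun_prop)
      | h k => simp only [← incl_star, ← incl_mul, star_mul]
  star_add x y := by
    induction x using dense_induction with
    | hp => exact isClosed_eq (by fun_prop) (by fun_prop)
    | h f =>
      induction y using dense_induction with
      | hp => exact isClosed_eq (by fun_prop) (by fun_prop)
      | h k => simp only [← incl_star, ← map_add, star_add]

instance : StarModule ℂ (CrossedProduct α) where
  star_smul z x := by
    induction x using dense_induction with
    | hp =>
      exact isClosed_eq (continuous_star'.comp (continuous_const_smul z))
        (continuous_star'.const_smul (star z))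
    | h f =>
      have h1 := congrArg (incl α) (star_smul z f)
      rw [incl_star, ContinuousLinearMap.map_smul, ContinuousLinearMap.map_smul, incl_star] at h1
      exact h1

instance : CStarRing (CrossedProduct α) where
  norm_mul_self_le x := by
    induction x using dense_induction with
    | hp => exact isClosed_le (by fun_prop) (by fun_prop)
    | h f =>
      rw [← incl_star, ← incl_mul, norm_incl, norm_incl]
      exact CovAlg.norm_mul_self_le f

instance : NonUnitalCStarAlgebra (CrossedProduct α) where

instance : PartialOrder (CrossedProduct α) := CStarAlgebra.spectralOrder _

instance : StarOrderedRing (CrossedProduct α) := CStarAlgebra.spectralOrderedRing _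

/-- The element `a δ_g` of `A ⋊_α G_d`. -/
def of (α : G →* (A ≃⋆ₐ[ℂ] A)) (g : G) (a : A) : CrossedProduct α := incl α (CovAlg.of α g a)

end CrossedProduct

/-! ## The universal covariant `L`-representation -/

section Universal

variable {G A L : Type u} [Group G] [TopologicalSpace G] [NonUnitalCStarAlgebra A]
  [NonUnitalCStarAlgebra L]

/-- A positive functional `ω` on a `C⋆`-algebra is a state if its norm is `1`. -/
def IsState {B : Type*} [NonUnitalCStarAlgebra B] [PartialOrder B] [StarOrderedRing B]
    (ω : B →ₚ[ℂ] ℂ) : Prop := IsLUB {r : ℝ | ∃ b : B, ‖b‖ ≤ 1 ∧ r = ‖ω b‖} 1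

/-- The set `𝔖_L` of those states `ω` of `A ⋊_α G_d` whose GNS representation is the integrated
form of a covariant `L`-representation of `(A, G, α)`. -/
def lStates (𝓛 : HostAlgebra G L) (α : G →* (A ≃⋆ₐ[ℂ] A)) :
    Set (CrossedProduct α →ₚ[ℂ] ℂ) :=
  {ω | IsState ω ∧
    ∃ P ∈ covLReps 𝓛 α ω.GNS, ∀ (g : G) (a : A),
      ω.gnsNonUnitalStarAlgHom (CrossedProduct.of α g a) =
        P.π.hom a * (P.U.hom g : ω.GNS →L[ℂ] ω.GNS)}

/-- The covariant `L`-representation `(π_ω, U_ω)` on the GNS space of `ω ∈ 𝔖_L`. -/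
def gnsCovRep (𝓛 : HostAlgebra G L) (α : G →* (A ≃⋆ₐ[ℂ] A)) (ω : lStates 𝓛 α) :
    CovRep α ω.1.GNS := ω.2.2.choose

/-- The Hilbert space `H_u = ⊕ H_ω`, the sum being over `ω ∈ 𝔖_L`. -/
abbrev UniversalSpace (𝓛 : HostAlgebra G L) (α : G →* (A ≃⋆ₐ[ℂ] A)) : Type u :=
  lp (fun ω : lStates 𝓛 α => ω.1.GNS) 2

/-- The universal covariant `L`-representation `(π_u, U_u) = ⊕ (π_ω, U_ω)`. -/
def universalRep (𝓛 : HostAlgebra G L) (α : G →* (A ≃⋆ₐ[ℂ] A)) :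
    CovRep α (UniversalSpace 𝓛 α) := CovRep.directSum (gnsCovRep 𝓛 α)

theorem universalRep_mem_covLReps (𝓛 : HostAlgebra G L) (α : G →* (A ≃⋆ₐ[ℂ] A)) :
    universalRep 𝓛 α ∈ covLReps 𝓛 α (UniversalSpace 𝓛 α) :=
  𝓛.isLRep_directSum _ fun ω => ω.2.2.choose_spec.1

end Universal

end

/-!
A cross representation `(π, U)` generates a crossed product host, and the universal one generates a
full host; conversely a full host forces every covariant `L`-representation to be cross. The link
is factorization: for a homomorphism `σ : L → B`, the elements `x` with `σ(e_i) x → x` along an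
approximate unit of `L` form a closed right ideal, `essentialIdeal σ`, and by Cohen's theorem
(`exists_eq_map_mul_of_mem_essentialIdeal`) it is exactly `σ(L)B`. So the cross condition
`π(A) U_L(L) ⊆ U_L(L) B(H)` says that `π(a) U_L(l)` lies in `essentialIdeal U_L`, a condition which
is closed and easy to propagate.

*From a full host to cross representations* (`IsFull.mem_crossReps`). Non-degeneracy of `η_L` puts
`C` inside `essentialIdeal η_L`, so `η_A(a) η_L(l) = η_L(l') y` with a multiplier `y`. The
representation `ρ` of `C` belonging to `(π, U)` is non-degenerate, its multiplier extension restores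
`π` and `U_L`, and it maps this factorization to `π(a) U_L(l) = U_L(l') T`.

*From the universal representation to a full host.* For a cross representation, let `C` be the
`C⋆`-algebra generated by `π(A) U_L(L)`. It is always idealized by `U_L(L)` and `U(G)`; the cross
condition is what puts `π(A)` into the idealizer of `C` and makes `U_L` act non-degenerately on `C`,
so that `C` is a host (`crossedHost`). For the universal
representation it is full: a covariant `L`-representation `(π, U)` extends to `C` once the
`C⋆`-algebra generated by the pairs `(π_u(a) U_{u,L}(l), π(a) U_L(l))` is the graph of a contraction
(`exists_starAlgHom_of_norm_le`). This is tested on one unit vector `ξ` at a time. The GNS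
representation of the vector state of `ξ` is the cyclic subrepresentation at `ξ`; its unitary part
is again an `L`-representation, because by injectivity of `π ↦ π̃ ∘ η` every unitary commuting with
`U(G)` commutes with `U_L(L)` (`commute_of_commute_pull`). Hence the vector state belongs to `𝔖_L`,
and `ξ` is the image of a unit vector of `H_u` under a contraction intertwining both representations
(`exists_intertwiner_universalRep`).
-/

/-! ### Approximate units and factorization -/

/-- The canonical approximate unit of a `C⋆`-algebra, formed with respect to the spectral order. -/
noncomputable def approxUnit (L : Type*) [NonUnitalCStarAlgebra L] : Filter L :=
  let _ := CStarAlgebra.spectralOrder L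
  let _ := CStarAlgebra.spectralOrderedRing L
  CStarAlgebra.approximateUnit L

section ApproxUnit

variable {L : Type*} [NonUnitalCStarAlgebra L]

instance approxUnit_neBot : (approxUnit L).NeBot :=
  let _ := CStarAlgebra.spectralOrder L
  let _ := CStarAlgebra.spectralOrderedRing L
  (CStarAlgebra.increasingApproximateUnit L).neBot

theorem tendsto_approxUnit_mul (l : L) : Tendsto (fun e => e * l) (approxUnit L) (𝓝 l) :=
  let _ := CStarAlgebra.spectralOrder L
  let _ := CStarAlgebra.spectralOrderedRing L
  (CStarAlgebra.increasingApproximateUnit L).tendsto_mul_right l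

theorem eventually_norm_approxUnit : ∀ᶠ e in approxUnit L, ‖e‖ ≤ 1 :=
  let _ := CStarAlgebra.spectralOrder L
  let _ := CStarAlgebra.spectralOrderedRing L
  (CStarAlgebra.increasingApproximateUnit L).eventually_norm

theorem eventually_eq_star_mul_self_approxUnit :
    ∀ᶠ e in approxUnit L, ∃ b : L, e = star b * b := by
  let _ := CStarAlgebra.spectralOrder L
  have _ := CStarAlgebra.spectralOrderedRing L
  filter_upwards [(CStarAlgebra.increasingApproximateUnit L).eventually_nonneg] with e he
  exact CStarAlgebra.nonneg_iff_eq_star_mul_self.mp he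

end ApproxUnit

section Factorization

variable {L B : Type*} [NonUnitalCStarAlgebra L] [NonUnitalCStarAlgebra B]

theorem continuous_starAlgHom (σ : L →⋆ₙₐ[ℂ] B) : Continuous σ :=
  AddMonoidHomClass.continuous_of_bound σ 1 fun l => by
    simpa only [one_mul] using NonUnitalStarAlgHom.norm_apply_le σ l

/-- The right ideal of all `x` with `σ(e_i) x → x` along the approximate unit of `L`. It is the
closed span of `σ(L)B`, and by factorization it even consists of products `σ(l) y`. -/
def essentialIdeal (σ : L →⋆ₙₐ[ℂ] B) : Submodule ℂ B where
  carrier := {x | Tendsto (fun e => σ e * x) (approxUnit L) (𝓝 x)}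
  add_mem' := fun {x y} hx hy => by
    simpa only [Set.mem_ofPred_eq, mul_add] using Tendsto.add hx hy
  zero_mem' := by simp
  smul_mem' := fun c x hx => by
    simpa only [Set.mem_ofPred_eq, mul_smul_comm] using Tendsto.const_smul hx c

variable {σ : L →⋆ₙₐ[ℂ] B}

theorem mem_essentialIdeal {x : B} :
    x ∈ essentialIdeal σ ↔ Tendsto (fun e => σ e * x) (approxUnit L) (𝓝 x) := Iff.rfl

theorem essentialIdeal_mul_mem {x : B} (hx : x ∈ essentialIdeal σ) (y : B) :
    x * y ∈ essentialIdeal σ := by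
  rw [mem_essentialIdeal] at hx ⊢
  simpa only [mul_assoc] using hx.mul_const y

theorem map_mul_mem_essentialIdeal (l : L) (y : B) : σ l * y ∈ essentialIdeal σ := by
  rw [mem_essentialIdeal]
  have h : Continuous fun l : L => σ l * y :=
    (continuous_starAlgHom σ).mul continuous_const
  simpa only [Function.comp_def, map_mul, mul_assoc] using
    (h.tendsto l).comp (tendsto_approxUnit_mul l)

theorem eventually_norm_map_mul_le (y : B) : ∀ᶠ e in approxUnit L, ‖σ e * y‖ ≤ ‖y‖ := by
  filter_upwards [eventually_norm_approxUnit] with e he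
  calc ‖σ e * y‖ ≤ ‖σ e‖ * ‖y‖ := norm_mul_le _ _
    _ ≤ 1 * ‖y‖ := by
        gcongr
        exact (NonUnitalStarAlgHom.norm_apply_le σ e).trans he
    _ = ‖y‖ := one_mul _

theorem isClosed_essentialIdeal : IsClosed (essentialIdeal σ : Set B) := by
  refine isClosed_of_closure_subset fun x hx => ?_
  refine Metric.tendsto_nhds.mpr fun ε hε => ?_
  obtain ⟨y, hy, hxy⟩ := Metric.mem_closure_iff.mp hx (ε / 3) (by positivity)
  filter_upwards [Metric.tendsto_nhds.mp (mem_essentialIdeal.mp hy) (ε / 3) (by positivity),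
    eventually_norm_map_mul_le (σ := σ) (x - y)] with e h1 h2
  rw [dist_eq_norm] at hxy h1 ⊢
  calc ‖σ e * x - x‖ = ‖σ e * (x - y) + (σ e * y - y) - (x - y)‖ := by
        congr 1
        rw [mul_sub]
        abel
    _ ≤ ‖σ e * (x - y)‖ + ‖σ e * y - y‖ + ‖x - y‖ :=
        (norm_sub_le _ _).trans (add_le_add_left (norm_add_le _ _) _)
    _ < ε := by linarith

/-- For `b ≥ 0` the operator `b + ε` is invertible with inverse of norm at most `ε⁻¹`. -/
theorem exists_add_smul_eq {D : Type*} [CStarAlgebra D] [PartialOrder D] [StarOrderedRing D]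
    {b : D} (hb : 0 ≤ b) {ε : ℝ} (hε : 0 < ε) (x : D) :
    ∃ y : D, b * y + (ε : ℂ) • y = x ∧ ε * ‖y‖ ≤ ‖x‖ := by
  have hu : IsUnit (b + algebraMap ℝ D ε) := by
    have h1 : -ε ∉ spectrum ℝ b := fun h => by
      have := spectrum_nonneg_of_nonneg hb h
      linarith
    have h2 := (spectrum.notMem_iff.mp h1).neg
    rwa [map_neg, neg_sub, sub_neg_eq_add] at h2
  obtain ⟨z, hz⟩ := hu
  have hz' : ∀ y : D, b * y + (ε : ℂ) • y = z * y := fun y => by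
    rw [hz, add_mul, ← Algebra.smul_def, Complex.coe_smul]
  refine ⟨↑z⁻¹ * x, by rw [hz', Units.mul_inv_cancel_left], ?_⟩
  set y := (↑z⁻¹ * x : D) with hy
  have hx : x = b * y + (ε : ℂ) • y := by rw [hz', hy, Units.mul_inv_cancel_left]
  -- `x⋆x = y⋆(b + ε)²y ≥ ε² y⋆y`
  have h3 : star x * x = ((ε : ℂ) • star y) * ((ε : ℂ) • y) +
      (star (b * y) * (b * y) + (2 * ε) • (star y * b * y)) := by
    rw [hx]
    simp only [star_add, star_mul, hb.star_eq, star_smul, star_trivial,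
      Complex.coe_smul, add_mul, mul_add, smul_add, smul_mul_assoc, mul_smul_comm, two_mul,
      add_smul, mul_assoc]
    abel
  have h4 : star ((ε : ℂ) • y) * ((ε : ℂ) • y) ≤ star x * x := by
    rw [h3, star_smul, Complex.star_def, Complex.conj_ofReal]
    refine le_add_of_nonneg_right (add_nonneg (star_mul_self_nonneg _) ?_)
    exact smul_nonneg (by positivity) (star_left_conjugate_nonneg hb y)
  have h5 := CStarAlgebra.norm_le_norm_of_nonneg_of_le (star_mul_self_nonneg _) h4
  rw [CStarRing.norm_star_mul_self, CStarRing.norm_star_mul_self, norm_smul, Complex.norm_real,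
    Real.norm_of_nonneg hε.le] at h5
  exact abs_le_of_sq_le_sq' (by nlinarith) (norm_nonneg x) |>.2

end Factorization

section Cohen

variable {L B : Type*} [NonUnitalCStarAlgebra L] [CStarAlgebra B] {σ : L →⋆ₙₐ[ℂ] B}

/-- The Cohen factorization theorem: each `x` with `σ(e_i) x → x` is a product `σ(l) y`. -/
theorem exists_eq_map_mul_of_mem_essentialIdeal {x : B} (hx : x ∈ essentialIdeal σ) :
    ∃ (l : L) (y : B), x = σ l * y := by
  let _ := CStarAlgebra.spectralOrder B
  have _ := CStarAlgebra.spectralOrderedRing B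
  -- The `n`-th approximation is `x = (σ(s) + 2⁻ⁿ) y` with `s = ∑ 2⁻ᵏ e_k`; the next `e` is chosen
  -- to almost fix the current `y`, which keeps the sequence of the `y` convergent.
  let Good : ℕ → L × B → Prop := fun n p =>
    0 ≤ σ p.1 ∧ p.2 ∈ essentialIdeal σ ∧ σ p.1 * p.2 + (((1 / 2 : ℝ) ^ n : ℝ) : ℂ) • p.2 = x
  have step : ∀ n p, Good n p → ∃ q, Good (n + 1) q ∧
      ‖p.1 - q.1‖ ≤ 1 / 2 * (1 / 2 : ℝ) ^ n ∧ ‖p.2 - q.2‖ ≤ 1 / 2 * (1 / 2 : ℝ) ^ n := by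
    rintro n ⟨s, y⟩ ⟨hs, hy, hxy⟩
    dsimp only at hs hy hxy
    set ε : ℝ := (1 / 2 : ℝ) ^ (n + 1) with hεd
    have hε : 0 < ε := by positivity
    have hn : (1 / 2 : ℝ) ^ n = 2 * ε := by rw [hεd, pow_succ]; ring
    obtain ⟨e, h1, ⟨b, hb⟩, h2⟩ := (eventually_norm_approxUnit.and
      (eventually_eq_star_mul_self_approxUnit.and
        (Metric.tendsto_nhds.mp (mem_essentialIdeal.mp hy) ε hε))).exists
    rw [dist_eq_norm'] at h2
    have he : 0 ≤ σ e := by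
      rw [hb, map_mul, map_star]
      exact star_mul_self_nonneg _
    have hs' : 0 ≤ σ (s + (ε : ℂ) • e) := by
      rw [map_add, map_smul, Complex.coe_smul]
      exact add_nonneg hs (smul_nonneg hε.le he)
    obtain ⟨w, hw, hwn⟩ := exists_add_smul_eq hs' hε ((ε : ℂ) • (y - σ e * y))
    refine ⟨(s + (ε : ℂ) • e, y + w), ⟨hs', ?_, ?_⟩, ?_, ?_⟩
    · refine add_mem hy ?_
      have h3 : w = (ε : ℂ)⁻¹ • ((ε : ℂ) • (y - σ e * y) - σ (s + (ε : ℂ) • e) * w) := by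
        rw [← hw, add_sub_cancel_left, smul_smul, inv_mul_cancel₀ (by exact_mod_cast hε.ne'),
          one_smul]
      rw [h3]
      exact Submodule.smul_mem _ _ (sub_mem (Submodule.smul_mem _ _
        (sub_mem hy (map_mul_mem_essentialIdeal e y))) (map_mul_mem_essentialIdeal _ w))
    · dsimp only
      have h4 : σ (s + (ε : ℂ) • e) * (y + w) + (ε : ℂ) • (y + w) =
          σ s * y + (ε : ℂ) • (σ e * y) + (ε : ℂ) • y +
            (σ (s + (ε : ℂ) • e) * w + (ε : ℂ) • w) := by
        rw [mul_add, smul_add]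
        nth_rw 1 [map_add]
        rw [map_smul, add_mul, smul_mul_assoc]
        abel
      rw [h4, hw, ← hxy, hn, smul_sub, Complex.ofReal_mul, mul_smul, Complex.ofReal_ofNat, two_smul]
      abel
    · dsimp only
      rw [hn, sub_add_cancel_left, norm_neg, norm_smul, Complex.norm_real,
        Real.norm_of_nonneg hε.le]
      nlinarith
    · dsimp only
      rw [hn, sub_add_cancel_left, norm_neg]
      rw [norm_smul, Complex.norm_real, Real.norm_of_nonneg hε.le] at hwn
      have := le_of_mul_le_mul_left hwn hε
      linarith
  obtain ⟨y₀, hy₀, -⟩ := exists_add_smul_eq (le_refl (0 : B)) zero_lt_one x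
  rw [zero_mul, zero_add, Complex.ofReal_one, one_smul] at hy₀
  subst hy₀
  have h0 : Good 0 (0, y₀) := ⟨by simp, hx, by simp⟩
  choose! next hnext hd1 hd2 using step
  let p : ℕ → L × B := fun n => Nat.rec (0, y₀) (fun n q => next n q) n
  have hp : ∀ n, Good n (p n) := fun n => by
    induction n with
    | zero => exact h0
    | succ n ih => exact hnext n _ ih
  have hc1 : CauchySeq fun n => (p n).1 :=
    cauchySeq_of_le_geometric (1 / 2) (1 / 2) (by norm_num) fun n => by
      rw [dist_eq_norm]
      exact hd1 n _ (hp n)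
  have hc2 : CauchySeq fun n => (p n).2 :=
    cauchySeq_of_le_geometric (1 / 2) (1 / 2) (by norm_num) fun n => by
      rw [dist_eq_norm]
      exact hd2 n _ (hp n)
  obtain ⟨l, hl⟩ := cauchySeq_tendsto_of_complete hc1
  obtain ⟨y, hy⟩ := cauchySeq_tendsto_of_complete hc2
  refine ⟨l, y, ?_⟩
  have h1 : Tendsto (fun n => σ (p n).1 * (p n).2 + (((1 / 2 : ℝ) ^ n : ℝ) : ℂ) • (p n).2) atTop
      (𝓝 (σ l * y + ((0 : ℝ) : ℂ) • y)) := by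
    refine ((((continuous_starAlgHom σ).tendsto l).comp hl).mul hy).add (Tendsto.smul ?_ hy)
    exact (Complex.continuous_ofReal.tendsto 0).comp
      (tendsto_pow_atTop_nhds_zero_of_lt_one (by norm_num) (by norm_num))
  simp only [fun n => (hp n).2.2, Complex.ofReal_zero, zero_smul, add_zero] at h1
  exact tendsto_nhds_unique tendsto_const_nhds h1

theorem mem_essentialIdeal_iff_exists {x : B} :
    x ∈ essentialIdeal σ ↔ ∃ (l : L) (y : B), x = σ l * y := by
  refine ⟨exists_eq_map_mul_of_mem_essentialIdeal, ?_⟩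
  rintro ⟨l, y, rfl⟩
  exact map_mul_mem_essentialIdeal l y

end Cohen

/-! ### Representations of host algebras and crossed product hosts -/

section Representations

variable {A : Type*} [NonUnitalCStarAlgebra A]
  {H : Type*} [NormedAddCommGroup H] [InnerProductSpace ℂ H] [CompleteSpace H]

theorem NDRep.eq_of_mul_left_eq (π : NDRep A H) {K : Type*} [NormedAddCommGroup K]
    [NormedSpace ℂ K] {S T : K →L[ℂ] H}
    (h : ∀ a, (π.hom a).comp S = (π.hom a).comp T) : S = T := by
  ext x
  rw [← sub_eq_zero]
  refine π.nondegenerate.eq_zero_of_inner_right (𝕜 := ℂ) fun v hv => ?_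
  induction hv using Submodule.span_induction with
  | mem v hv =>
    obtain ⟨a, y, rfl⟩ := hv
    have h1 : π.hom (star a) (S x - T x) = 0 := by
      rw [map_sub, sub_eq_zero]
      exact congrArg (fun R : K →L[ℂ] H => R x) (h (star a))
    rw [← ContinuousLinearMap.adjoint_inner_right, ← ContinuousLinearMap.star_eq_adjoint,
      ← map_star, h1, inner_zero_right]
  | zero => exact inner_zero_left _
  | add v w _ _ hv hw => rw [inner_add_left, hv, hw, add_zero]
  | smul c v _ hv => rw [inner_smul_left, hv, mul_zero]

theorem NDRep.dense_span_apply_apply {L : Type*} [NonUnitalCStarAlgebra L]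
    (π : NDRep A H) (σ : NDRep L H) :
    Dense (Submodule.span ℂ {x : H | ∃ a l y, x = π.hom a (σ.hom l y)} : Set H) := by
  set S := Submodule.span ℂ {x : H | ∃ a l y, x = π.hom a (σ.hom l y)}
  have h1 : ∀ a y, π.hom a y ∈ S.topologicalClosure := by
    intro a y
    refine map_mem_closure (π.hom a).continuous (σ.nondegenerate y) fun v hv => ?_
    induction hv using Submodule.span_induction with
    | mem v hv =>
      obtain ⟨l, z, rfl⟩ := hv
      exact Submodule.subset_span ⟨a, l, z, rfl⟩
    | zero => rw [map_zero]; exact zero_mem S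
    | add v w _ _ hv hw => rw [map_add]; exact add_mem hv hw
    | smul c v _ hv => rw [map_smul]; exact S.smul_mem c hv
  have h2 : Submodule.span ℂ {x : H | ∃ a y, x = π.hom a y} ≤ S.topologicalClosure := by
    rw [Submodule.span_le]
    rintro _ ⟨a, y, rfl⟩
    exact h1 a y
  intro x
  exact closure_minimal h2 S.isClosed_topologicalClosure (π.nondegenerate x)

end Representations

theorem UnitaryRep.ext_hom {G H : Type*} [Group G] [TopologicalSpace G] [NormedAddCommGroup H]
    [InnerProductSpace ℂ H] [CompleteSpace H] {U V : UnitaryRep G H}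
    (h : ∀ g, (U.hom g : H →L[ℂ] H) = V.hom g) : U = V := by
  obtain ⟨U, hU⟩ := U
  obtain ⟨V, hV⟩ := V
  obtain rfl : U = V := MonoidHom.ext fun g => Subtype.ext (h g)
  rfl

theorem multiplier_coe_injective {C : Type*} [NonUnitalCStarAlgebra C] :
    Function.Injective fun c : C => (c : 𝓜(ℂ, C)) := fun _ _ h =>
  eq_of_forall_mul_left_eq fun b => congrArg (fun M : 𝓜(ℂ, C) => M.snd b) h

namespace HostAlgebra

variable {G L : Type u} [Group G] [TopologicalSpace G] [NonUnitalCStarAlgebra L]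
  {H : Type u} [NormedAddCommGroup H] [InnerProductSpace ℂ H] [CompleteSpace H]

theorem pull_injective (𝓛 : HostAlgebra G L) {π σ : NDRep L H} (h : 𝓛.pull π = 𝓛.pull σ) :
    π = σ :=
  𝓛.ext_injective H π σ fun g =>
    congrArg (fun U : UnitaryRep G H => (U.hom g : H →L[ℂ] H)) h

theorem lift_eq (𝓛 : HostAlgebra G L) {U : UnitaryRep G H} (hU : 𝓛.IsLRep U) {π : NDRep L H}
    (h : 𝓛.pull π = U) : 𝓛.lift hU = π :=
  𝓛.pull_injective ((𝓛.pull_lift hU).trans h.symm)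

theorem hom_mul_lift (𝓛 : HostAlgebra G L) {U : UnitaryRep G H} (hU : 𝓛.IsLRep U) (g : G)
    (l : L) : (U.hom g : H →L[ℂ] H) * (𝓛.lift hU).hom l =
      (𝓛.lift hU).hom ((𝓛.η g : 𝓜(ℂ, L)).fst l) := by
  have h1 : (U.hom g : H →L[ℂ] H) = (𝓛.lift hU).ext (𝓛.η g : 𝓜(ℂ, L)) :=
    congrArg (fun V : UnitaryRep G H => (V.hom g : H →L[ℂ] H)) (𝓛.pull_lift hU).symm
  rw [h1]
  ext x
  exact (𝓛.lift hU).ext_apply _ l x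

end HostAlgebra

namespace CrossedProductHost

variable {G A L : Type u} [Group G] [TopologicalSpace G] [NonUnitalCStarAlgebra A]
  [NonUnitalCStarAlgebra L] {𝓛 : HostAlgebra G L} {α : G →* (A ≃⋆ₐ[ℂ] A)}
  {C : Type u} [NonUnitalCStarAlgebra C]

/-- Non-degeneracy of `η_L`, in the form needed for factorization in `M(C)`. -/
theorem coe_mem_essentialIdeal (K : CrossedProductHost 𝓛 α C) (c : C) :
    (c : 𝓜(ℂ, C)) ∈ essentialIdeal K.ηL := by
  have hc : Continuous fun c : C => (c : 𝓜(ℂ, C)) :=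
    continuous_starAlgHom (DoubleCentralizer.coeHom (𝕜 := ℂ) (A := C))
  refine closure_minimal (s := (Submodule.span ℂ {x : C | ∃ a b, x = (K.ηL a).fst b} : Set C))
    (t := {c : C | (c : 𝓜(ℂ, C)) ∈ essentialIdeal K.ηL}) (fun x hx => ?_)
    (isClosed_essentialIdeal.preimage hc) (K.nondegenerate c)
  induction hx using Submodule.span_induction with
  | mem x hx =>
    obtain ⟨l, b, rfl⟩ := hx
    rw [Set.mem_ofPred_eq, ← multiplier_mul_coe]
    exact map_mul_mem_essentialIdeal l _
  | zero =>
    rw [Set.mem_ofPred_eq, ← DoubleCentralizer.coeHom_apply (𝕜 := ℂ), map_zero]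
    exact zero_mem _
  | add x y _ _ hx hy =>
    rw [Set.mem_ofPred_eq, ← DoubleCentralizer.coeHom_apply (𝕜 := ℂ), map_add]
    exact add_mem hx hy
  | smul c x _ hx =>
    rw [Set.mem_ofPred_eq, ← DoubleCentralizer.coeHom_apply (𝕜 := ℂ), map_smul]
    exact Submodule.smul_mem _ c hx

/-- The representation of a full crossed product host belonging to a covariant `L`-representation
`(π, U)` is non-degenerate, and its multiplier extension gives back `π` and `U_L`. By
factorization, `η_A(a) η_L(l) ∈ η_L(L) M(C)`. -/
theorem IsFull.mem_crossReps {K : CrossedProductHost 𝓛 α C} (hK : K.IsFull)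
    {H : Type u} [NormedAddCommGroup H] [InnerProductSpace ℂ H] [CompleteSpace H]
    {P : CovRep α H} (hP : P ∈ covLReps 𝓛 α H) : P ∈ crossReps 𝓛 α H := by
  have hU : 𝓛.IsLRep P.U := hP
  refine ⟨hU, fun a l => ?_⟩
  obtain ⟨ρ, hρ, -⟩ := hK H P hU
  set σ := 𝓛.lift hU
  have hd := P.π.dense_span_apply_apply σ
  have happ : ∀ a l, ∃ c : C, (c : 𝓜(ℂ, C)) = K.ηA a * K.ηL l ∧ ∀ y,
      ρ c y = P.π.hom a (σ.hom l y) := fun a l => by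
    obtain ⟨c, hc⟩ := K.mul_mem a l
    exact ⟨c, hc, fun y => by rw [hρ a l c hc]; rfl⟩
  let R : NDRep C H := ⟨ρ, hd.mono (Submodule.span_mono (by
    rintro _ ⟨a, l, y, rfl⟩
    obtain ⟨c, -, hc⟩ := happ a l
    exact ⟨c, y, (hc y).symm⟩))⟩
  have hRA : ∀ a, R.ext (K.ηA a) = P.π.hom a := by
    intro a
    refine clm_eq_of_dense_span hd ?_
    rintro _ ⟨b, m, y, rfl⟩
    obtain ⟨c, hc, hcy⟩ := happ b m
    obtain ⟨c', hc', hcy'⟩ := happ (a * b) m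
    have h1 : (K.ηA a).fst c = c' := by
      refine multiplier_coe_injective ?_
      change (((K.ηA a).fst c : C) : 𝓜(ℂ, C)) = (c' : 𝓜(ℂ, C))
      rw [← multiplier_mul_coe, hc, hc', map_mul, mul_assoc]
    rw [← hcy, show ρ c y = R.hom c y from rfl, R.ext_apply, h1]
    change ρ c' y = _
    rw [hcy', hcy, map_mul]
    rfl
  have hRL : ∀ l, R.ext (K.ηL l) = σ.hom l := by
    intro l
    refine P.π.eq_of_mul_left_eq fun a => ?_
    obtain ⟨c, hc, hcy⟩ := happ a l
    rw [← hRA]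
    change R.ext (K.ηA a) * R.ext (K.ηL l) = R.ext (K.ηA a) * σ.hom l
    rw [← map_mul, ← hc, R.ext_coe, hRA]
    ext y
    exact hcy y
  obtain ⟨c, hc⟩ := K.mul_mem a l
  obtain ⟨l', y, hy⟩ := exists_eq_map_mul_of_mem_essentialIdeal (K.coe_mem_essentialIdeal c)
  refine ⟨l', R.ext y, ?_⟩
  rw [← hRA, ← hRL, ← hRL, ← map_mul, ← map_mul, ← hy, hc]

end CrossedProductHost

/-! ### Idealizers and subalgebras generated by products -/

section Idealizer

variable {B : Type*} [CStarAlgebra B]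

/-- The idealizer of a `⋆`-subalgebra `C` of `B`: all `x` with `xC ⊆ C` and `Cx ⊆ C`. -/
def starIdealizer (C : NonUnitalStarSubalgebra ℂ B) : StarSubalgebra ℂ B where
  carrier := {x | ∀ c ∈ C, x * c ∈ C ∧ c * x ∈ C}
  mul_mem' := fun {x y} hx hy c hc =>
    ⟨by rw [mul_assoc]; exact (hx _ (hy c hc).1).1, by rw [← mul_assoc]; exact (hy _ (hx c hc).2).2⟩
  add_mem' := fun {x y} hx hy c hc =>
    ⟨by rw [add_mul]; exact add_mem (hx c hc).1 (hy c hc).1,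
      by rw [mul_add]; exact add_mem (hx c hc).2 (hy c hc).2⟩
  algebraMap_mem' := fun r c hc => by
    simp only [Algebra.algebraMap_eq_smul_one, smul_one_mul, mul_smul_one]
    exact ⟨C.smul_mem r hc, C.smul_mem r hc⟩
  star_mem' := fun {x} hx c hc => by
    have h := hx _ (star_mem hc)
    exact ⟨by simpa using star_mem h.2, by simpa using star_mem h.1⟩

variable {C : NonUnitalStarSubalgebra ℂ B}

/-- As `C` is self-adjoint, `xC ⊆ C` and `x⋆C ⊆ C` suffice. -/
theorem mem_starIdealizer_of {x : B} (h : ∀ c ∈ C, x * c ∈ C) (h' : ∀ c ∈ C, star x * c ∈ C) :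
    x ∈ starIdealizer C := fun c hc =>
  ⟨h c hc, by simpa using star_mem (h' _ (star_mem hc))⟩

/-- The idealizer of `C` acts on `C` by multipliers. -/
noncomputable def idealizerHom (C : NonUnitalStarSubalgebra ℂ B) [IsClosed (C : Set B)] :
    starIdealizer C →⋆ₐ[ℂ] 𝓜(ℂ, C) where
  toFun x :=
    { fst :=
        { toFun := fun c => ⟨x * c, (x.2 c c.2).1⟩
          map_add' := fun c d => Subtype.ext (mul_add _ _ _)
          map_smul' := fun r c => Subtype.ext (mul_smul_comm _ _ _)
          cont := by fun_prop }
      snd :=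
        { toFun := fun c => ⟨c * x, (x.2 c c.2).2⟩
          map_add' := fun c d => Subtype.ext (add_mul _ _ _)
          map_smul' := fun r c => Subtype.ext (smul_mul_assoc _ _ _)
          cont := by fun_prop }
      central := fun c d => Subtype.ext (mul_assoc _ _ _) }
  map_one' := NonDegenerate.multiplier_ext (by ext c; simp)
  map_zero' := NonDegenerate.multiplier_ext (by ext c; simp)
  map_add' x y := NonDegenerate.multiplier_ext (by ext c; simp [add_mul])
  map_mul' x y := NonDegenerate.multiplier_ext (by ext c; simp [mul_assoc])
  commutes' r := NonDegenerate.multiplier_ext (by ext c; simp [Algebra.algebraMap_eq_smul_one])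
  map_star' x := NonDegenerate.multiplier_ext (by ext c; simp)

@[simp]
theorem coe_idealizerHom_fst_apply [IsClosed (C : Set B)] (x : starIdealizer C) (c : C) :
    (((idealizerHom C x).fst c : C) : B) = x * c := rfl

end Idealizer

section Adjoin

variable {B : Type*} [NonUnitalCStarAlgebra B]

/-- A closed right ideal containing a set and its adjoints contains the `C⋆`-algebra generated by
the set. -/
theorem topologicalClosure_adjoin_subset_of_right_ideal {s : Set B} (S : Submodule ℂ B)
    (hS : IsClosed (S : Set B))
    (hmul : ∀ x ∈ S, ∀ y ∈ (NonUnitalStarAlgebra.adjoin ℂ s).topologicalClosure, x * y ∈ S)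
    (hs : ∀ x ∈ s, x ∈ S) (hs' : ∀ x ∈ s, star x ∈ S) {c : B}
    (hc : c ∈ (NonUnitalStarAlgebra.adjoin ℂ s).topologicalClosure) : c ∈ S := by
  refine closure_minimal (fun x hx => ?_) hS hc
  have hx' : x ∈ NonUnitalAlgebra.adjoin ℂ (s ∪ star s) := by
    rw [← NonUnitalStarAlgebra.adjoin_toNonUnitalSubalgebra]
    exact hx
  clear hx hc
  induction hx' using NonUnitalAlgebra.adjoin_induction with
  | mem x hx =>
    rcases hx with hx | hx
    · exact hs x hx
    · simpa using hs' _ hx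
  | add x y _ _ hx hy => exact add_mem hx hy
  | zero => exact zero_mem S
  | mul x y _ hy hx _ =>
    refine hmul x hx y (NonUnitalStarSubalgebra.le_topologicalClosure _ ?_)
    rw [← NonUnitalStarAlgebra.adjoin_toNonUnitalSubalgebra] at hy
    exact hy
  | smul r x _ hx => exact S.smul_mem r hx

theorem subset_topologicalClosure_adjoin (s : Set B) :
    s ⊆ (NonUnitalStarAlgebra.adjoin ℂ s).topologicalClosure :=
  (NonUnitalStarAlgebra.subset_adjoin ℂ s).trans
    (NonUnitalStarSubalgebra.le_topologicalClosure _)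

instance isClosed_topologicalClosure_adjoin (s : Set B) :
    IsClosed ((NonUnitalStarAlgebra.adjoin ℂ s).topologicalClosure : Set B) :=
  NonUnitalStarSubalgebra.isClosed_topologicalClosure _

/-- A set generates, inside the `C⋆`-algebra which it generates, this whole `C⋆`-algebra. -/
theorem topologicalClosure_adjoin_preimage_eq_top (s : Set B) :
    (NonUnitalStarAlgebra.adjoin ℂ
      {c : (NonUnitalStarAlgebra.adjoin ℂ s).topologicalClosure | (c : B) ∈ s}).topologicalClosure =
        ⊤ := by
  set C := (NonUnitalStarAlgebra.adjoin ℂ s).topologicalClosure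
  have h1 : NonUnitalStarAlgebra.adjoin ℂ s ≤ (NonUnitalStarAlgebra.adjoin ℂ
      {c : C | (c : B) ∈ s}).map (NonUnitalStarSubalgebraClass.subtype C) := by
    refine NonUnitalStarAlgebra.adjoin_le fun x hx => ?_
    exact ⟨⟨x, subset_topologicalClosure_adjoin s hx⟩,
      NonUnitalStarAlgebra.subset_adjoin ℂ _ hx, rfl⟩
  refine eq_top_iff.mpr fun c _ => ?_
  change c ∈ closure _
  rw [Topology.IsInducing.subtypeVal.closure_eq_preimage_closure_image]
  exact closure_mono h1 c.2

theorem starAlgHom_eq_of_topologicalClosure_adjoin_eq_top {D : Type*} [NonUnitalCStarAlgebra D]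
    {s : Set B} (hs : (NonUnitalStarAlgebra.adjoin ℂ s).topologicalClosure = ⊤)
    {φ ψ : B →⋆ₙₐ[ℂ] D} (h : ∀ x ∈ s, φ x = ψ x) : φ = ψ := by
  have h1 : (NonUnitalStarAlgebra.adjoin ℂ s) ≤ NonUnitalStarAlgHom.equalizer φ ψ :=
    NonUnitalStarAlgebra.adjoin_le h
  ext x
  have hx : x ∈ (NonUnitalStarAlgebra.adjoin ℂ s).topologicalClosure := hs ▸ trivial
  exact closure_minimal (t := {x | φ x = ψ x}) h1
    (isClosed_eq (continuous_starAlgHom φ) (continuous_starAlgHom ψ)) hx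

/-- If the `C⋆`-algebra generated by the pairs `(f i, g i)` is the graph of a contraction, then
`f i ↦ g i` extends to a homomorphism on the `C⋆`-algebra generated by the `f i`. -/
theorem exists_starAlgHom_of_norm_le {D ι : Type*} [NonUnitalCStarAlgebra D] (f : ι → B) (g : ι → D)
    (h : ∀ x ∈ (NonUnitalStarAlgebra.adjoin ℂ
      (Set.range fun i => (f i, g i))).topologicalClosure, ‖x.2‖ ≤ ‖x.1‖) :
    ∃ ρ : (NonUnitalStarAlgebra.adjoin ℂ (Set.range f)).topologicalClosure →⋆ₙₐ[ℂ] D,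
      ∀ (i : ι) (c : (NonUnitalStarAlgebra.adjoin ℂ (Set.range f)).topologicalClosure),
        (c : B) = f i → ρ c = g i := by
  set E := (NonUnitalStarAlgebra.adjoin ℂ (Set.range fun i => (f i, g i))).topologicalClosure
    with hE
  set C := (NonUnitalStarAlgebra.adjoin ℂ (Set.range f)).topologicalClosure with hC
  have hEC : ∀ x ∈ E, x.1 ∈ C := by
    have h1 : NonUnitalStarAlgebra.adjoin ℂ (Set.range fun i => (f i, g i)) ≤
        C.comap (NonUnitalStarAlgHom.fst ℂ B D) := by
      refine NonUnitalStarAlgebra.adjoin_le ?_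
      rintro _ ⟨i, rfl⟩
      exact subset_topologicalClosure_adjoin _ ⟨i, rfl⟩
    exact fun x hx => closure_minimal (t := {x : B × D | x.1 ∈ C}) h1
      ((isClosed_topologicalClosure_adjoin _).preimage continuous_fst) hx
  let p : E →⋆ₙₐ[ℂ] C := NonUnitalStarAlgHom.codRestrict
    ((NonUnitalStarAlgHom.fst ℂ B D).comp (NonUnitalStarSubalgebraClass.subtype E)) C
    fun x => hEC x x.2
  have hp : ∀ x, ‖p x‖ = ‖x‖ := fun x => (max_eq_left (h x x.2)).symm
  have hpi : Isometry p := AddMonoidHomClass.isometry_of_norm p hp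
  have hsurj : Function.Surjective p := by
    have hr : IsClosed (Set.range p) := hpi.isClosedEmbedding.isClosed_range
    have h2 := topologicalClosure_adjoin_preimage_eq_top (Set.range f)
    have h3 : NonUnitalStarAlgebra.adjoin ℂ {c : C | (c : B) ∈ Set.range f} ≤
        NonUnitalStarAlgHom.range p := by
      refine NonUnitalStarAlgebra.adjoin_le ?_
      rintro c ⟨i, hi⟩
      exact ⟨⟨(f i, g i), subset_topologicalClosure_adjoin _ ⟨i, rfl⟩⟩, Subtype.ext hi⟩
    intro c
    have hc : c ∈ (NonUnitalStarAlgebra.adjoin ℂ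
      {c : C | (c : B) ∈ Set.range f}).topologicalClosure := h2 ▸ trivial
    exact closure_minimal h3 hr hc
  let e : E ≃⋆ₐ[ℂ] C := StarAlgEquiv.ofBijective p ⟨hpi.injective, hsurj⟩
  refine ⟨(((NonUnitalStarAlgHom.snd ℂ B D).comp (NonUnitalStarSubalgebraClass.subtype E)).comp
    (e.symm : C →⋆ₙₐ[ℂ] E)), fun i c hc => ?_⟩
  have h4 : e.symm c = ⟨(f i, g i), subset_topologicalClosure_adjoin _ ⟨i, rfl⟩⟩ := by
    rw [StarAlgEquiv.symm_apply_eq]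
    exact Subtype.ext hc
  change (e.symm c : B × D).2 = g i
  rw [h4]

end Adjoin

section ProductAlgebra

variable {A L B : Type*} [NonUnitalCStarAlgebra A] [NonUnitalCStarAlgebra L] [CStarAlgebra B]

/-- The `C⋆`-algebra generated by the products `π(a) σ(l)`. -/
noncomputable def productAlgebra (π : A →⋆ₙₐ[ℂ] B) (σ : L →⋆ₙₐ[ℂ] B) :
    NonUnitalStarSubalgebra ℂ B :=
  (NonUnitalStarAlgebra.adjoin ℂ
    (Set.range fun p : A × L => π p.1 * σ p.2)).topologicalClosure

variable {π : A →⋆ₙₐ[ℂ] B} {σ : L →⋆ₙₐ[ℂ] B}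

instance isClosed_productAlgebra : IsClosed (productAlgebra π σ : Set B) :=
  isClosed_topologicalClosure_adjoin _

theorem mul_mem_productAlgebra (a : A) (l : L) : π a * σ l ∈ productAlgebra π σ :=
  subset_topologicalClosure_adjoin _ ⟨(a, l), rfl⟩

theorem mul_mem_productAlgebra' (a : A) (l : L) : σ l * π a ∈ productAlgebra π σ := by
  have h := star_mem (mul_mem_productAlgebra (π := π) (σ := σ) (star a) (star l))
  simpa only [star_mul, ← map_star, star_star] using h

/-- Left multiplication by `x` need only be tested on the generators and their adjoints: the `c`
with `xc` in the algebra form a closed right ideal. -/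
theorem mul_mem_productAlgebra_of {x : B} (h : ∀ a l, x * (π a * σ l) ∈ productAlgebra π σ)
    (h' : ∀ a l, x * (σ l * π a) ∈ productAlgebra π σ) :
    ∀ c ∈ productAlgebra π σ, x * c ∈ productAlgebra π σ := by
  intro c hc
  refine topologicalClosure_adjoin_subset_of_right_ideal
    ((productAlgebra π σ).toSubmodule.comap (LinearMap.mulLeft ℂ x))
    (isClosed_productAlgebra.preimage (continuous_const_mul x)) (fun y hy z hz => ?_) ?_ ?_ hc
  · change x * (y * z) ∈ productAlgebra π σ
    rw [← mul_assoc]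
    exact mul_mem hy hz
  · rintro _ ⟨p, rfl⟩
    exact h p.1 p.2
  · rintro _ ⟨p, rfl⟩
    change x * star (π p.1 * σ p.2) ∈ productAlgebra π σ
    rw [star_mul, ← map_star, ← map_star]
    exact h' _ _

theorem map_mem_starIdealizer_right (l : L) : σ l ∈ starIdealizer (productAlgebra π σ) := by
  have key : ∀ l, ∀ c ∈ productAlgebra π σ, σ l * c ∈ productAlgebra π σ := by
    intro l
    refine mul_mem_productAlgebra_of (fun a m => ?_) fun a m => ?_
    · -- `σ(l) π(e a) σ(m) = (σ(l) π(e)) (π(a) σ(m))` with `e` in an approximate unit of `A`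
      have ht : Tendsto (fun e => σ l * (π (e * a) * σ m)) (approxUnit A)
          (𝓝 (σ l * (π a * σ m))) :=
        ((((continuous_starAlgHom π).tendsto a).comp (tendsto_approxUnit_mul a)).mul_const
          (σ m)).const_mul (σ l)
      refine isClosed_productAlgebra.mem_of_tendsto ht (Eventually.of_forall fun e => ?_)
      have h1 : σ l * (π (e * a) * σ m) = (σ l * π e) * (π a * σ m) := by
        rw [map_mul]
        simp only [mul_assoc]
      rw [h1]
      exact mul_mem (mul_mem_productAlgebra' e l) (mul_mem_productAlgebra a m)
    · rw [← mul_assoc, ← map_mul]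
      exact mul_mem_productAlgebra' a _
  refine mem_starIdealizer_of (key l) ?_
  rw [← map_star]
  exact key _

/-- The cross condition turns `π(A)` into multipliers of the `C⋆`-algebra generated by
`π(A)σ(L)`. -/
theorem map_mem_starIdealizer_left (hc : ∀ a l, π a * σ l ∈ essentialIdeal σ) (a : A) :
    π a ∈ starIdealizer (productAlgebra π σ) := by
  have key : ∀ a, ∀ c ∈ productAlgebra π σ, π a * c ∈ productAlgebra π σ := by
    intro a
    refine mul_mem_productAlgebra_of (fun b l => ?_) fun b l => ?_
    · rw [← mul_assoc, ← map_mul]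
      exact mul_mem_productAlgebra _ l
    · -- `π(a) σ(l) π(b)` is the limit of the products `(π(a) σ(l)) (π(b) σ(e⋆))`
      have h1 := ((mem_essentialIdeal.mp (hc (star b) (star l))).star).const_mul (π a)
      have h2 : π a * star (π (star b) * σ (star l)) = π a * (σ l * π b) := by
        simp only [star_mul, ← map_star, star_star]
      rw [h2] at h1
      refine isClosed_productAlgebra.mem_of_tendsto h1 (Eventually.of_forall fun e => ?_)
      have h3 : π a * star (σ e * (π (star b) * σ (star l))) =
          (π a * σ l) * (π b * σ (star e)) := by
        simp only [star_mul, ← map_star, star_star, mul_assoc]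
      rw [h3]
      exact mul_mem (mul_mem_productAlgebra a l) (mul_mem_productAlgebra b _)
  refine mem_starIdealizer_of (key a) ?_
  rw [← map_star]
  exact key _

theorem mul_mem_productAlgebra_of_normalizes {u : B} (hA : ∀ a, ∃ a', u * π a = π a' * u)
    (hL : ∀ l, ∃ l', u * σ l = σ l') :
    ∀ c ∈ productAlgebra π σ, u * c ∈ productAlgebra π σ := by
  refine mul_mem_productAlgebra_of (fun a l => ?_) fun a l => ?_
  · obtain ⟨a', ha⟩ := hA a
    obtain ⟨l', hl⟩ := hL l
    rw [← mul_assoc, ha, mul_assoc, hl]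
    exact mul_mem_productAlgebra a' l'
  · obtain ⟨l', hl⟩ := hL l
    rw [← mul_assoc, hl]
    exact mul_mem_productAlgebra' a l'

theorem productAlgebra_subset_essentialIdeal (hc : ∀ a l, π a * σ l ∈ essentialIdeal σ) :
    ∀ c ∈ productAlgebra π σ, c ∈ essentialIdeal σ := fun c hcc => by
  refine topologicalClosure_adjoin_subset_of_right_ideal (essentialIdeal σ) isClosed_essentialIdeal
    (fun x hx y _ => essentialIdeal_mul_mem hx y) ?_ ?_ hcc
  · rintro _ ⟨p, rfl⟩
    exact hc p.1 p.2
  · rintro _ ⟨p, rfl⟩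
    rw [star_mul, ← map_star]
    exact map_mul_mem_essentialIdeal _ _

end ProductAlgebra

/-! ### The crossed product host of a cross representation -/

section IdealizerLift

variable {A B : Type*} [NonUnitalCStarAlgebra A] [CStarAlgebra B] {C : NonUnitalStarSubalgebra ℂ B}
  [IsClosed (C : Set B)]

/-- A homomorphism into the idealizer of `C`, as a morphism into the multipliers of `C`. -/
noncomputable def idealizerLift (φ : A →⋆ₙₐ[ℂ] B) (h : ∀ a, φ a ∈ starIdealizer C) :
    A →⋆ₙₐ[ℂ] 𝓜(ℂ, C) where
  toFun a := idealizerHom C ⟨φ a, h a⟩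
  map_smul' r a := by
    rw [← map_smul]
    exact congrArg _ (Subtype.ext (map_smul φ r a))
  map_zero' := by
    rw [← map_zero (idealizerHom C)]
    exact congrArg _ (Subtype.ext (map_zero φ))
  map_add' a b := by
    rw [← map_add]
    exact congrArg _ (Subtype.ext (map_add φ a b))
  map_mul' a b := by
    rw [← map_mul]
    exact congrArg _ (Subtype.ext (map_mul φ a b))
  map_star' a := by
    rw [← map_star]
    exact congrArg _ (Subtype.ext (map_star φ a))

@[simp]
theorem coe_idealizerLift_fst_apply (φ : A →⋆ₙₐ[ℂ] B) (h : ∀ a, φ a ∈ starIdealizer C) (a : A)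
    (c : C) : (((idealizerLift φ h a).fst c : C) : B) = φ a * c := rfl

end IdealizerLift

section CrossedHost

variable {G A L : Type u} [Group G] [TopologicalSpace G] [NonUnitalCStarAlgebra A]
  [NonUnitalCStarAlgebra L] {𝓛 : HostAlgebra G L} {α : G →* (A ≃⋆ₐ[ℂ] A)}
  {H : Type u} [NormedAddCommGroup H] [InnerProductSpace ℂ H] [CompleteSpace H]

theorem CovRep.U_mul_π (P : CovRep α H) (g : G) (a : A) :
    (P.U.hom g : H →L[ℂ] H) * P.π.hom a = P.π.hom (α g a) * (P.U.hom g : H →L[ℂ] H) :=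
  P.toDiscrete.U_mul_π g a

/-- The `C⋆`-algebra generated by `π(A) U_L(L)`. -/
noncomputable abbrev CovRep.productAlgebra (P : CovRep α H) (hU : 𝓛.IsLRep P.U) :
    NonUnitalStarSubalgebra ℂ (H →L[ℂ] H) :=
  _root_.productAlgebra P.π.hom (𝓛.lift hU).hom

theorem CovRep.U_mem_starIdealizer (P : CovRep α H) (hU : 𝓛.IsLRep P.U) (g : G) :
    (P.U.hom g : H →L[ℂ] H) ∈ starIdealizer (P.productAlgebra hU) := by
  have key : ∀ g : G, ∀ c ∈ P.productAlgebra hU,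
      (P.U.hom g : H →L[ℂ] H) * c ∈ P.productAlgebra hU := fun g =>
    mul_mem_productAlgebra_of_normalizes (fun a => ⟨_, P.U_mul_π g a⟩)
      fun l => ⟨_, 𝓛.hom_mul_lift hU g l⟩
  refine mem_starIdealizer_of (key g) ?_
  have h1 : star (P.U.hom g : H →L[ℂ] H) = P.U.hom g⁻¹ := by
    rw [map_inv]
    rfl
  rw [h1]
  exact key _

theorem nonDegenerate_idealizerLift {B : Type*} [CStarAlgebra B]
    {C : NonUnitalStarSubalgebra ℂ B} [IsClosed (C : Set B)] (σ : L →⋆ₙₐ[ℂ] B)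
    (h : ∀ l, σ l ∈ starIdealizer C) (hC : ∀ c ∈ C, c ∈ essentialIdeal σ) :
    NonDegenerate (idealizerLift σ h) := by
  intro c
  have ht : Tendsto (fun e => (idealizerLift σ h e).fst c) (approxUnit L) (𝓝 c) :=
    tendsto_subtype_rng.mpr (mem_essentialIdeal.mp (hC c c.2))
  exact mem_closure_of_tendsto ht
    (Eventually.of_forall fun e => Submodule.subset_span ⟨e, c, rfl⟩)

theorem mul_mem_essentialIdeal_of_mem_crossReps {P : CovRep α H} (hP : P ∈ crossReps 𝓛 α H)
    (hU : 𝓛.IsLRep P.U) (a : A) (l : L) :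
    P.π.hom a * (𝓛.lift hU).hom l ∈ essentialIdeal (𝓛.lift hU).hom := by
  obtain ⟨hU', h⟩ := hP
  exact mem_essentialIdeal_iff_exists.mpr (h a l)

theorem ext_eta_eq_idealizerHom (P : CovRep α H) (hU : 𝓛.IsLRep P.U)
    (hn : NonDegenerate (idealizerLift (C := P.productAlgebra hU) (𝓛.lift hU).hom
      map_mem_starIdealizer_right)) (g : G) :
    hn.ext (𝓛.η g : 𝓜(ℂ, L)) =
      idealizerHom (P.productAlgebra hU) ⟨P.U.hom g, P.U_mem_starIdealizer hU g⟩ := by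
  refine hn.extMul_unique _ _ fun l c => Subtype.ext ?_
  simp only [coe_idealizerHom_fst_apply, coe_idealizerLift_fst_apply]
  rw [← mul_assoc, 𝓛.hom_mul_lift hU]

/-- The `C⋆`-algebra generated by `π(A) U_L(L)`, for a cross representation `(π, U)`, is a crossed
product host. -/
noncomputable def crossedHost (P : CovRep α H) (hP : P ∈ crossReps 𝓛 α H) (hU : 𝓛.IsLRep P.U) :
    CrossedProductHost 𝓛 α (P.productAlgebra hU) where
  ηA := idealizerLift P.π.hom
    (map_mem_starIdealizer_left (mul_mem_essentialIdeal_of_mem_crossReps hP hU))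
  ηL := idealizerLift (𝓛.lift hU).hom map_mem_starIdealizer_right
  nondegenerate := nonDegenerate_idealizerLift _ _
    (productAlgebra_subset_essentialIdeal (mul_mem_essentialIdeal_of_mem_crossReps hP hU))
  covariant g a := by
    rw [ext_eta_eq_idealizerHom, ← map_star]
    refine NonDegenerate.multiplier_ext (ContinuousLinearMap.ext fun c => Subtype.ext ?_)
    exact (mul_assoc _ _ _).symm.trans ((mul_assoc _ _ _).symm.trans
      (congrArg (fun T => T * (c : H →L[ℂ] H)) (P.covariant g a)))
  mul_mem a l := ⟨⟨_, mul_mem_productAlgebra a l⟩, NonDegenerate.multiplier_ext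
    (ContinuousLinearMap.ext fun c => Subtype.ext (mul_assoc _ _ _))⟩
  generates := by
    have h := topologicalClosure_adjoin_preimage_eq_top
      (Set.range fun p : A × L => P.π.hom p.1 * (𝓛.lift hU).hom p.2)
    refine top_le_iff.mp (h.symm.le.trans (NonUnitalStarSubalgebra.topologicalClosure_mono
      (NonUnitalStarAlgebra.adjoin_mono ?_)))
    rintro c ⟨p, hp⟩
    refine ⟨p.1, p.2, NonDegenerate.multiplier_ext
      (ContinuousLinearMap.ext fun d => Subtype.ext ?_)⟩
    exact (congrArg (fun T => T * (d : H →L[ℂ] H)) hp.symm).trans (mul_assoc _ _ _)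

theorem coe_eq_of_coe_eq_crossedHost {P : CovRep α H} (hP : P ∈ crossReps 𝓛 α H)
    (hU : 𝓛.IsLRep P.U) {a : A} {l : L} {c : P.productAlgebra hU}
    (hc : (c : 𝓜(ℂ, P.productAlgebra hU)) =
      (crossedHost P hP hU).ηA a * (crossedHost P hP hU).ηL l) :
    (c : H →L[ℂ] H) = P.π.hom a * (𝓛.lift hU).hom l := by
  have h1 : (⟨_, mul_mem_productAlgebra a l⟩ : P.productAlgebra hU) = c := by
    refine multiplier_coe_injective (Eq.trans ?_ hc.symm)
    exact NonDegenerate.multiplier_ext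
      (ContinuousLinearMap.ext fun d => Subtype.ext (mul_assoc _ _ _))
  rw [← h1]

/-- The crossed product host of a cross representation `P` is full if `P` dominates every covariant
`L`-representation. -/
theorem isFull_crossedHost {P : CovRep α H} (hP : P ∈ crossReps 𝓛 α H) (hU : 𝓛.IsLRep P.U)
    (h : ∀ (K : Type u) [NormedAddCommGroup K] [InnerProductSpace ℂ K] [CompleteSpace K]
      (Q : CovRep α K) (hQ : 𝓛.IsLRep Q.U), ∀ x ∈ (NonUnitalStarAlgebra.adjoin ℂ
        (Set.range fun p : A × L => (P.π.hom p.1 * (𝓛.lift hU).hom p.2,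
          Q.π.hom p.1 * (𝓛.lift hQ).hom p.2))).topologicalClosure, ‖x.2‖ ≤ ‖x.1‖) :
    (crossedHost P hP hU).IsFull := by
  intro K _ _ _ Q hQ
  obtain ⟨ρ, hρ⟩ := exists_starAlgHom_of_norm_le
    (fun p : A × L => P.π.hom p.1 * (𝓛.lift hU).hom p.2)
    (fun p : A × L => Q.π.hom p.1 * (𝓛.lift hQ).hom p.2) (h K Q hQ)
  refine ⟨ρ, fun a l c hc => hρ (a, l) c (coe_eq_of_coe_eq_crossedHost hP hU hc), fun ψ hψ => ?_⟩
  refine starAlgHom_eq_of_topologicalClosure_adjoin_eq_top (crossedHost P hP hU).generates ?_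
  rintro c ⟨a, l, hc⟩
  rw [hψ a l c hc]
  exact (hρ (a, l) c (coe_eq_of_coe_eq_crossedHost hP hU hc)).symm

end CrossedHost

/-! ### Intertwiners and subrepresentations -/

section Intertwiners

variable {H K : Type*} [NormedAddCommGroup H] [InnerProductSpace ℂ H] [CompleteSpace H]
  [NormedAddCommGroup K] [InnerProductSpace ℂ K] [CompleteSpace K]

/-- `T` intertwines the families `φ` and `ψ` of operators. -/
def Intertwines {D : Type*} (T : K →L[ℂ] H) (φ : D → K →L[ℂ] K) (ψ : D → H →L[ℂ] H) : Prop :=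
  ∀ d x, T (φ d x) = ψ d (T x)

theorem Intertwines.adjoint {D : Type*} [NonUnitalCStarAlgebra D] {T : K →L[ℂ] H}
    {φ : D →⋆ₙₐ[ℂ] (K →L[ℂ] K)} {ψ : D →⋆ₙₐ[ℂ] (H →L[ℂ] H)} (h : Intertwines T φ ψ) :
    Intertwines (ContinuousLinearMap.adjoint T) ψ φ := by
  intro d x
  have h1 : T.comp (φ (star d)) = (ψ (star d)).comp T := ContinuousLinearMap.ext (h (star d))
  have h2 := congrArg ContinuousLinearMap.adjoint h1
  rw [ContinuousLinearMap.adjoint_comp, ContinuousLinearMap.adjoint_comp,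
    ← ContinuousLinearMap.star_eq_adjoint (φ _), ← ContinuousLinearMap.star_eq_adjoint (ψ _),
    ← map_star, ← map_star, star_star] at h2
  exact (congrArg (fun S : H →L[ℂ] K => S x) h2).symm

theorem adjoint_apply_apply_of_norm_map {W : K →L[ℂ] H} (hW : ∀ x, ‖W x‖ = ‖x‖) (x : K) :
    ContinuousLinearMap.adjoint W (W x) = x :=
  congrArg (fun S : K →L[ℂ] K => S x)
    ((ContinuousLinearMap.norm_map_iff_adjoint_comp_self W).mp hW)

theorem norm_adjoint_apply_le_of_norm_map {W : K →L[ℂ] H} (hW : ∀ x, ‖W x‖ = ‖x‖) (y : H) :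
    ‖ContinuousLinearMap.adjoint W y‖ ≤ ‖y‖ := by
  have h1 : ‖W‖ ≤ 1 := W.opNorm_le_bound zero_le_one fun x => by rw [hW, one_mul]
  calc ‖ContinuousLinearMap.adjoint W y‖ ≤ ‖ContinuousLinearMap.adjoint W‖ * ‖y‖ :=
        ContinuousLinearMap.le_opNorm _ _
    _ ≤ 1 * ‖y‖ := by
        gcongr
        rwa [LinearIsometryEquiv.norm_map]
    _ = ‖y‖ := one_mul _

/-- Restriction of a `⋆`-homomorphism into `B(H)` to an invariant subspace, given as the range of
an isometry. -/
noncomputable def compressHom {D : Type*} [NonUnitalCStarAlgebra D] (φ : D →⋆ₙₐ[ℂ] (H →L[ℂ] H))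
    (W : K →L[ℂ] H)
    (h : ∀ d x, W (ContinuousLinearMap.adjoint W (φ d (W x))) = φ d (W x)) :
    D →⋆ₙₐ[ℂ] (K →L[ℂ] K) where
  toFun d := (ContinuousLinearMap.adjoint W).comp ((φ d).comp W)
  map_smul' c d := by ext x; simp
  map_zero' := by ext x; simp
  map_add' d e := by ext x; simp
  map_mul' d e := by
    ext x
    simp [h]
  map_star' d := by
    rw [map_star, ContinuousLinearMap.star_eq_adjoint, ContinuousLinearMap.star_eq_adjoint,
      ContinuousLinearMap.adjoint_comp, ContinuousLinearMap.adjoint_comp,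
      ContinuousLinearMap.adjoint_adjoint]
    rfl

/-- Restriction of a representation to an invariant subspace. -/
noncomputable def NDRep.compress {D : Type*} [NonUnitalCStarAlgebra D] (π : NDRep D H)
    (W : K →L[ℂ] H) (hW : ∀ x, ‖W x‖ = ‖x‖)
    (h : ∀ d x, W (ContinuousLinearMap.adjoint W (π.hom d (W x))) = π.hom d (W x)) :
    NDRep D K where
  hom := compressHom π.hom W h
  nondegenerate := by
    intro k
    have hi : Intertwines W (compressHom π.hom W h) π.hom := h
    rw [← adjoint_apply_apply_of_norm_map hW k]
    refine map_mem_closure (ContinuousLinearMap.continuous _) (π.nondegenerate (W k))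
      fun y hy => ?_
    induction hy using Submodule.span_induction with
    | mem y hy =>
      obtain ⟨d, z, rfl⟩ := hy
      exact Submodule.subset_span ⟨d, ContinuousLinearMap.adjoint W z, hi.adjoint d z⟩
    | zero => rw [map_zero]; exact Submodule.zero_mem _
    | add y z _ _ hy hz => rw [map_add]; exact Submodule.add_mem _ hy hz
    | smul c y _ hy => rw [map_smul]; exact Submodule.smul_mem _ c hy

variable {D : Type*} [NonUnitalCStarAlgebra D] (π : NDRep D H) (W : K →L[ℂ] H)
  (hW : ∀ x, ‖W x‖ = ‖x‖)
  (h : ∀ d x, W (ContinuousLinearMap.adjoint W (π.hom d (W x))) = π.hom d (W x))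

theorem NDRep.intertwines_compress : Intertwines W (π.compress W hW h).hom π.hom := h

theorem NDRep.compress_ext_apply (M : 𝓜(ℂ, D)) (x : K) :
    (π.compress W hW h).ext M x = ContinuousLinearMap.adjoint W (π.ext M (W x)) := by
  have h1 : (π.compress W hW h).extOp M =
      (ContinuousLinearMap.adjoint W).comp ((π.ext M).comp W) := by
    refine (π.compress W hW h).extOp_unique _ _ fun d y => ?_
    change ContinuousLinearMap.adjoint W (π.ext M (W _)) = _
    rw [π.intertwines_compress W hW h d y, π.ext_apply]
    rfl
  exact congrArg (fun S : K →L[ℂ] K => S x) h1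

end Intertwiners

section LRepIntertwiners

variable {G L : Type u} [Group G] [TopologicalSpace G] [NonUnitalCStarAlgebra L]
  {H K : Type u} [NormedAddCommGroup H] [InnerProductSpace ℂ H] [CompleteSpace H]
  [NormedAddCommGroup K] [InnerProductSpace ℂ K] [CompleteSpace K]

namespace HostAlgebra

variable (𝓛 : HostAlgebra G L)

/-- The injectivity of `π ↦ π̃ ∘ η` implies that a unitary commuting with `U(G)` commutes with
`U_L(L)`: it conjugates `U_L` into a representation with the same image. -/
theorem commute_of_commute_pull (σ : NDRep L H) (V : unitary (H →L[ℂ] H))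
    (hV : ∀ g x, (V : H →L[ℂ] H) (σ.ext (𝓛.η g : 𝓜(ℂ, L)) x) =
      σ.ext (𝓛.η g : 𝓜(ℂ, L)) ((V : H →L[ℂ] H) x)) (l : L) (x : H) :
    (V : H →L[ℂ] H) (σ.hom l x) = σ.hom l ((V : H →L[ℂ] H) x) := by
  have hn : ∀ x, ‖(V : H →L[ℂ] H) x‖ = ‖x‖ := ContinuousLinearMap.norm_map_of_mem_unitary V.2
  have hVV : ∀ x, (V : H →L[ℂ] H) (ContinuousLinearMap.adjoint (V : H →L[ℂ] H) x) = x := fun x =>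
    congrArg (fun S : H →L[ℂ] H => S x) (Unitary.coe_mul_star_self V)
  have h1 : σ.compress V hn (fun d x => hVV _) = σ := by
    refine 𝓛.ext_injective H _ _ fun g => ContinuousLinearMap.ext fun x => ?_
    rw [NDRep.compress_ext_apply, ← hV, adjoint_apply_apply_of_norm_map hn]
  have h2 := σ.intertwines_compress V hn (fun d x => hVV _) l x
  rwa [h1] at h2

/-- An isometry which intertwines a unitary representation `U` with an `L`-representation `V`
exhibits `U` as an `L`-representation and intertwines the representations of `L`. -/
theorem exists_pull_eq_of_intertwines {U : UnitaryRep G K} (σ : NDRep L H) (W : K →L[ℂ] H)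
    (hW : ∀ x, ‖W x‖ = ‖x‖)
    (hU : Intertwines W (fun g => (U.hom g : K →L[ℂ] K))
      (fun g => ((𝓛.pull σ).hom g : H →L[ℂ] H))) :
    ∃ τ : NDRep L K, 𝓛.pull τ = U ∧ Intertwines W τ.hom σ.hom := by
  set W' := ContinuousLinearMap.adjoint W with hW'
  have hWW : ∀ x, W' (W x) = x := adjoint_apply_apply_of_norm_map hW
  -- the projection `W W⋆` commutes with the unitary group
  have hadj : ∀ g x, W' (((𝓛.pull σ).hom g : H →L[ℂ] H) x) = (U.hom g : K →L[ℂ] K) (W' x) := by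
    intro g x
    have h1 : ∀ g : G, ContinuousLinearMap.adjoint (U.hom g : K →L[ℂ] K) = U.hom g⁻¹ := fun g => by
      rw [map_inv]
      rfl
    have h2 : ∀ g : G, ContinuousLinearMap.adjoint ((𝓛.pull σ).hom g : H →L[ℂ] H) =
        (𝓛.pull σ).hom g⁻¹ := fun g => by
      rw [map_inv]
      rfl
    have h3 : W.comp (U.hom g⁻¹ : K →L[ℂ] K) = ((𝓛.pull σ).hom g⁻¹ : H →L[ℂ] H).comp W :=
      ContinuousLinearMap.ext (hU g⁻¹)
    have h4 := congrArg ContinuousLinearMap.adjoint h3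
    rw [ContinuousLinearMap.adjoint_comp, ContinuousLinearMap.adjoint_comp, h1, h2, inv_inv] at h4
    exact (congrArg (fun S : H →L[ℂ] K => S x) h4).symm
  -- the reflection `1 - 2 W W⋆`
  set p : H →L[ℂ] H := W.comp W' with hp
  have hps : star p = p := by
    rw [ContinuousLinearMap.star_eq_adjoint, hp, ContinuousLinearMap.adjoint_comp, hW',
      ContinuousLinearMap.adjoint_adjoint]
  have hpp : p * p = p := ContinuousLinearMap.ext fun x => congrArg W (hWW (W' x))
  have hV : (1 - 2 • p) ∈ unitary (H →L[ℂ] H) := by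
    have h1 : (1 - 2 • p) * (1 - 2 • p) = 1 := by
      rw [sub_mul, one_mul, mul_sub, mul_one, smul_mul_smul_comm, hpp]
      module
    have h2 : star (1 - 2 • p) = 1 - 2 • p := by
      rw [star_sub, star_one, star_nsmul, hps]
    rw [Unitary.mem_iff, h2]
    exact ⟨h1, h1⟩
  have hcomm := 𝓛.commute_of_commute_pull σ ⟨_, hV⟩ fun g x => by
    have h1 : p (((𝓛.pull σ).hom g : H →L[ℂ] H) x) = ((𝓛.pull σ).hom g : H →L[ℂ] H) (p x) :=
      (congrArg W (hadj g x)).trans (hU g (W' x))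
    have h2 : p (σ.ext (𝓛.η g : 𝓜(ℂ, L)) x) = σ.ext (𝓛.η g : 𝓜(ℂ, L)) (p x) := h1
    simp [h2]
  have hpσ : ∀ l x, p (σ.hom l x) = σ.hom l (p x) := by
    intro l x
    have h1 := hcomm l x
    simp only [sub_apply, one_apply_eq_self, smul_apply, map_sub,
      map_nsmul, sub_right_inj] at h1
    rw [two_smul, two_smul, ← two_smul ℂ, ← two_smul ℂ] at h1
    exact smul_right_injective H (two_ne_zero (α := ℂ)) h1
  have hinv : ∀ l x, W (W' (σ.hom l (W x))) = σ.hom l (W x) := fun l x => by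
    change p (σ.hom l (W x)) = _
    rw [hpσ]
    exact congrArg (fun y => σ.hom l (W y)) (hWW x)
  refine ⟨σ.compress W hW hinv, UnitaryRep.ext_hom fun g => ContinuousLinearMap.ext fun x => ?_,
    σ.intertwines_compress W hW hinv⟩
  refine (σ.compress_ext_apply W hW hinv _ x).trans ?_
  refine (hadj g (W x)).trans ?_
  rw [hWW]

theorem intertwines_lift {U : UnitaryRep G K} {V : UnitaryRep G H} (hU : 𝓛.IsLRep U)
    (hV : 𝓛.IsLRep V) {W : K →L[ℂ] H} (hW : ∀ x, ‖W x‖ = ‖x‖)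
    (h : Intertwines W (fun g => (U.hom g : K →L[ℂ] K)) (fun g => (V.hom g : H →L[ℂ] H))) :
    Intertwines W (𝓛.lift hU).hom (𝓛.lift hV).hom := by
  obtain ⟨τ, hτ, h1⟩ := 𝓛.exists_pull_eq_of_intertwines (U := U) (𝓛.lift hV) W hW
    (by rwa [𝓛.pull_lift hV])
  rwa [𝓛.lift_eq hU hτ]

end HostAlgebra

end LRepIntertwiners

/-! ### Vector states and their GNS representations -/

section VectorStates

variable {B : Type*} [NonUnitalCStarAlgebra B]
  {H : Type*} [NormedAddCommGroup H] [InnerProductSpace ℂ H] [CompleteSpace H]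

theorem NDRep.tendsto_approxUnit (ρ : NDRep B H) (x : H) :
    Tendsto (fun e => ρ.hom e x) (approxUnit B) (𝓝 x) := by
  refine Metric.tendsto_nhds.mpr fun ε hε => ?_
  have key : ∀ y ∈ Submodule.span ℂ {x : H | ∃ a y, x = ρ.hom a y},
      Tendsto (fun e => ρ.hom e y) (approxUnit B) (𝓝 y) := by
    intro y hy
    induction hy using Submodule.span_induction with
    | mem y hy =>
      obtain ⟨a, z, rfl⟩ := hy
      have h1 : Continuous fun b => ρ.hom b z := (continuous_starAlgHom ρ.hom).clm_apply
        continuous_const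
      have h2 := (h1.tendsto a).comp (tendsto_approxUnit_mul a)
      simpa only [Function.comp_def, map_mul, mul_apply_eq_comp] using h2
    | zero => simp
    | add y z _ _ hy hz => simpa only [map_add] using hy.add hz
    | smul c y _ hy => simpa only [map_smul] using hy.const_smul c
  obtain ⟨y, hy, hxy⟩ := Metric.mem_closure_iff.mp (ρ.nondegenerate x) (ε / 3) (by positivity)
  filter_upwards [Metric.tendsto_nhds.mp (key y hy) (ε / 3) (by positivity),
    eventually_norm_approxUnit] with e h1 h2
  have h3 : ‖ρ.hom e (x - y)‖ ≤ ‖x - y‖ := by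
    calc ‖ρ.hom e (x - y)‖ ≤ ‖ρ.hom e‖ * ‖x - y‖ := ContinuousLinearMap.le_opNorm _ _
      _ ≤ 1 * ‖x - y‖ := by
          gcongr
          exact (NonUnitalStarAlgHom.norm_apply_le ρ.hom e).trans h2
      _ = ‖x - y‖ := one_mul _
  rw [dist_eq_norm] at hxy h1 ⊢
  calc ‖ρ.hom e x - x‖ = ‖ρ.hom e (x - y) + (ρ.hom e y - y) - (x - y)‖ := by
        congr 1
        rw [map_sub]
        abel
    _ ≤ ‖ρ.hom e (x - y)‖ + ‖ρ.hom e y - y‖ + ‖x - y‖ :=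
        (norm_sub_le _ _).trans (add_le_add_left (norm_add_le _ _) _)
    _ < ε := by linarith

/-- The vector `ξ` itself lies in the image of the GNS space, as `ρ` is non-degenerate. -/
theorem mem_range_of_isometry {K : Type*} [NormedAddCommGroup K] [InnerProductSpace ℂ K]
    [CompleteSpace K] {W : K →L[ℂ] H} (hW : ∀ x, ‖W x‖ = ‖x‖) (ρ : NDRep B H) {ξ : H}
    (h : ∀ b, ρ.hom b ξ ∈ Set.range W) : ξ ∈ Set.range W := by
  have hi : Isometry W := AddMonoidHomClass.isometry_of_norm W hW
  exact hi.isClosedEmbedding.isClosed_range.mem_of_tendsto (ρ.tendsto_approxUnit ξ)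
    (Eventually.of_forall h)

theorem inner_self_eq_ofReal_norm_sq {E : Type*} [NormedAddCommGroup E] [InnerProductSpace ℂ E]
    (v : E) : ⟪v, v⟫_ℂ = ((‖v‖ ^ 2 : ℝ) : ℂ) := by
  rw [inner_self_eq_norm_sq_to_K, Complex.ofReal_pow]
  rfl

variable [PartialOrder B] [StarOrderedRing B]

/-- The positive functional `b ↦ ⟪ξ, ρ(b) ξ⟫`. -/
noncomputable def vectorFunctional (ρ : B →⋆ₙₐ[ℂ] (H →L[ℂ] H)) (ξ : H) : B →ₚ[ℂ] ℂ :=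
  PositiveLinearMap.mk₀
    { toFun := fun b => ⟪ξ, ρ b ξ⟫_ℂ
      map_add' := fun a b => by simp
      map_smul' := fun c b => by simp }
    fun b hb => by
      obtain ⟨c, rfl⟩ := CStarAlgebra.nonneg_iff_eq_star_mul_self.mp hb
      change 0 ≤ ⟪ξ, ρ (star c * c) ξ⟫_ℂ
      rw [map_mul, map_star, ContinuousLinearMap.star_eq_adjoint, mul_apply_eq_comp,
        ContinuousLinearMap.adjoint_inner_right, inner_self_eq_ofReal_norm_sq]
      exact Complex.zero_le_real.mpr (sq_nonneg _)

theorem vectorFunctional_apply (ρ : B →⋆ₙₐ[ℂ] (H →L[ℂ] H)) (ξ : H) (b : B) :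
    vectorFunctional ρ ξ b = ⟪ξ, ρ b ξ⟫_ℂ := rfl

theorem isState_vectorFunctional (ρ : NDRep B H) {ξ : H} (hξ : ‖ξ‖ = 1) :
    IsState (vectorFunctional ρ.hom ξ) := by
  constructor
  · rintro _ ⟨b, hb, rfl⟩
    rw [vectorFunctional_apply]
    calc ‖⟪ξ, ρ.hom b ξ⟫_ℂ‖ ≤ ‖ξ‖ * ‖ρ.hom b ξ‖ := norm_inner_le_norm _ _
      _ ≤ ‖ξ‖ * (‖ρ.hom b‖ * ‖ξ‖) := by
          gcongr
          exact ContinuousLinearMap.le_opNorm _ _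
      _ = ‖ρ.hom b‖ := by rw [hξ, one_mul, mul_one]
      _ ≤ 1 := (NonUnitalStarAlgHom.norm_apply_le ρ.hom b).trans hb
  · intro c hc
    have h1 : Tendsto (fun e => ‖⟪ξ, ρ.hom e ξ⟫_ℂ‖) (approxUnit B) (𝓝 1) := by
      have h2 := (tendsto_const_nhds (x := ξ)).inner (𝕜 := ℂ) (ρ.tendsto_approxUnit ξ)
      simpa [inner_self_eq_norm_sq_to_K, hξ] using h2.norm
    refine le_of_tendsto h1 ?_
    filter_upwards [eventually_norm_approxUnit] with e he
    exact hc ⟨e, he, rfl⟩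

/-- The GNS space of a vector functional embeds isometrically as the closure of `ρ(B)ξ`. -/
theorem exists_isometry_gns_vectorFunctional (ρ : B →⋆ₙₐ[ℂ] (H →L[ℂ] H)) (ξ : H) :
    ∃ W : (vectorFunctional ρ ξ).GNS →L[ℂ] H, (∀ x, ‖W x‖ = ‖x‖) ∧
      Intertwines W (vectorFunctional ρ ξ).gnsNonUnitalStarAlgHom ρ ∧
      ∀ b, ρ b ξ ∈ Set.range W := by
  set ω := vectorFunctional ρ ξ
  have hn : ∀ x : ω.PreGNS, ‖ρ (ω.ofPreGNS x) ξ‖ = ‖x‖ := by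
    intro x
    rw [ω.preGNS_norm_def, vectorFunctional_apply, map_mul, map_star,
      ContinuousLinearMap.star_eq_adjoint, mul_apply_eq_comp,
      ContinuousLinearMap.adjoint_inner_right, inner_self_eq_ofReal_norm_sq,
      Complex.ofReal_re, Real.sqrt_sq (norm_nonneg _)]
  let W₀ : ω.PreGNS →L[ℂ] H := LinearMap.mkContinuous
    { toFun := fun x => ρ (ω.ofPreGNS x) ξ
      map_add' := fun x y => by simp
      map_smul' := fun c x => by simp } 1 fun x => by
        rw [one_mul]
        exact (hn x).le
  have hW : ∀ x : ω.PreGNS, W₀.fromCompletion (x : ω.GNS) = ρ (ω.ofPreGNS x) ξ := fun x =>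
    W₀.fromCompletion_apply_coe x
  refine ⟨W₀.fromCompletion, fun x => ?_, fun b x => ?_, fun b => ⟨(ω.toPreGNS b : ω.PreGNS), ?_⟩⟩
  · induction x using UniformSpace.Completion.induction_on with
    | hp => exact isClosed_eq (by fun_prop) (by fun_prop)
    | ih x => rw [hW, hn, UniformSpace.Completion.norm_coe]
  · induction x using UniformSpace.Completion.induction_on with
    | hp => exact isClosed_eq (by fun_prop) (by fun_prop)
    | ih x =>
      rw [ω.gnsNonUnitalStarAlgHom_apply_coe, hW, hW, ω.leftMulMapPreGNS_apply,
        ω.ofPreGNS_toPreGNS, map_mul]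
      rfl
  · rw [hW, ω.ofPreGNS_toPreGNS]

end VectorStates

section Integration

variable {G A : Type u} [Group G] [NonUnitalCStarAlgebra A] {α : G →* (A ≃⋆ₐ[ℂ] A)}
  {H : Type u} [NormedAddCommGroup H] [InnerProductSpace ℂ H] [CompleteSpace H]

namespace DiscreteCovRep

open CrossedProduct

/-- The integrated form of a covariant representation on the crossed product, as a linear map. -/
noncomputable def extendLin (P : DiscreteCovRep α H) : CrossedProduct α →L[ℂ] (H →L[ℂ] H) :=
  (P.integrateLin.mkContinuous 1 fun f => by
    rw [one_mul]
    exact CovAlg.norm_integrate_le P f).extend (incl α)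

theorem extendLin_incl (P : DiscreteCovRep α H) (f : CovAlg α) :
    P.extendLin (incl α f) = P.integrate f :=
  ContinuousLinearMap.extend_eq _ denseRange_incl isUniformInducing_incl f

/-- The integrated form of a covariant representation on the crossed product. -/
noncomputable def extendHom (P : DiscreteCovRep α H) : CrossedProduct α →⋆ₙₐ[ℂ] (H →L[ℂ] H) where
  toFun := P.extendLin
  map_smul' := map_smul P.extendLin
  map_zero' := map_zero P.extendLin
  map_add' := map_add P.extendLin
  map_mul' x y := by
    induction x using dense_induction with
    | hp => exact isClosed_eq (by fun_prop) (by fun_prop)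
    | h f =>
      induction y using dense_induction with
      | hp => exact isClosed_eq (by fun_prop) (by fun_prop)
      | h k => rw [← incl_mul, extendLin_incl, extendLin_incl, extendLin_incl, map_mul]
  map_star' x := by
    induction x using dense_induction with
    | hp => exact isClosed_eq (by fun_prop) (by fun_prop)
    | h f => rw [← incl_star, extendLin_incl, extendLin_incl, map_star]

theorem extendHom_of (P : DiscreteCovRep α H) (g : G) (a : A) :
    P.extendHom (CrossedProduct.of α g a) = P.π.hom a * (P.U g : H →L[ℂ] H) :=
  (P.extendLin_incl _).trans (P.integrate_of g a)

theorem extendHom_of_one (P : DiscreteCovRep α H) (a : A) :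
    P.extendHom (CrossedProduct.of α 1 a) = P.π.hom a := by
  rw [extendHom_of, map_one, OneMemClass.coe_one, mul_one]

/-- The integrated form of a covariant representation is non-degenerate. -/
noncomputable def extend (P : DiscreteCovRep α H) : NDRep (CrossedProduct α) H where
  hom := P.extendHom
  nondegenerate := P.π.nondegenerate.mono (Submodule.span_mono (by
    rintro _ ⟨a, y, rfl⟩
    exact ⟨CrossedProduct.of α 1 a, y, by rw [extendHom_of_one]⟩))

end DiscreteCovRep

end Integration

/-! ### Cyclic subrepresentations and domination by the universal representation -/

section Cyclic

variable {G A L : Type u} [Group G] [TopologicalSpace G] [NonUnitalCStarAlgebra A]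
  [NonUnitalCStarAlgebra L] {α : G →* (A ≃⋆ₐ[ℂ] A)}
  {H K : Type u} [NormedAddCommGroup H] [InnerProductSpace ℂ H] [CompleteSpace H]
  [NormedAddCommGroup K] [InnerProductSpace ℂ K] [CompleteSpace K]

/-- Restriction of a unitary representation to an invariant subspace, given as the range of an
isometry. -/
noncomputable def UnitaryRep.compress (U : UnitaryRep G H) (W : K →L[ℂ] H) (hW : ∀ x, ‖W x‖ = ‖x‖)
    (h : ∀ g x, W (ContinuousLinearMap.adjoint W ((U.hom g : H →L[ℂ] H) (W x))) =
      (U.hom g : H →L[ℂ] H) (W x)) : UnitaryRep G K where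
  hom :=
    { toFun := fun g =>
        ⟨(ContinuousLinearMap.adjoint W).comp ((U.hom g : H →L[ℂ] H).comp W), by
          have hs : star ((ContinuousLinearMap.adjoint W).comp ((U.hom g : H →L[ℂ] H).comp W)) =
              (ContinuousLinearMap.adjoint W).comp ((U.hom g⁻¹ : H →L[ℂ] H).comp W) := by
            rw [ContinuousLinearMap.star_eq_adjoint, ContinuousLinearMap.adjoint_comp,
              ContinuousLinearMap.adjoint_comp, ContinuousLinearMap.adjoint_adjoint, map_inv]
            rfl
          have hm : ∀ (g : G) (x : H),
              (U.hom g : H →L[ℂ] H) ((U.hom g⁻¹ : H →L[ℂ] H) x) = x := fun g x => by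
            rw [map_inv]
            exact congrArg (fun S : H →L[ℂ] H => S x) (Unitary.coe_mul_star_self (U.hom g))
          rw [Unitary.mem_iff, hs]
          constructor
          · ext x
            have := hm g⁻¹ (W x)
            rw [inv_inv] at this
            simp only [mul_apply_eq_comp, ContinuousLinearMap.comp_apply, one_apply_eq_self, h,
              this, adjoint_apply_apply_of_norm_map hW]
          · ext x
            simp only [mul_apply_eq_comp, ContinuousLinearMap.comp_apply, one_apply_eq_self, h, hm,
              adjoint_apply_apply_of_norm_map hW]⟩
      map_one' := by
        ext x
        simp [adjoint_apply_apply_of_norm_map hW]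
      map_mul' := fun g k => by
        ext x
        simp [h] }
  continuous_apply x :=
    (ContinuousLinearMap.continuous (ContinuousLinearMap.adjoint W)).comp
      (U.continuous_apply (W x))

theorem UnitaryRep.intertwines_compress (U : UnitaryRep G H) (W : K →L[ℂ] H)
    (hW : ∀ x, ‖W x‖ = ‖x‖)
    (h : ∀ g x, W (ContinuousLinearMap.adjoint W ((U.hom g : H →L[ℂ] H) (W x))) =
      (U.hom g : H →L[ℂ] H) (W x)) :
    Intertwines W (fun g => ((U.compress W hW h).hom g : K →L[ℂ] K))
      (fun g => (U.hom g : H →L[ℂ] H)) := h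

theorem CovRep.U_apply_π_apply (P : CovRep α H) (g : G) (a : A) (x : H) :
    (P.U.hom g : H →L[ℂ] H) (P.π.hom a x) = P.π.hom (α g a) ((P.U.hom g : H →L[ℂ] H) x) :=
  congrArg (fun S : H →L[ℂ] H => S x) (P.U_mul_π g a)

/-- An isometry onto a subspace which is invariant under the integrated form of a covariant
representation `P` restricts `P` to a covariant representation. -/
theorem CovRep.exists_compress (P : CovRep α H) (W : K →L[ℂ] H) (hW : ∀ x, ‖W x‖ = ‖x‖)
    (γ : CrossedProduct α →⋆ₙₐ[ℂ] (K →L[ℂ] K)) (hγ : Intertwines W γ P.toDiscrete.extendHom) :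
    ∃ Q : CovRep α K, Intertwines W Q.π.hom P.π.hom ∧
      Intertwines W (fun g => (Q.U.hom g : K →L[ℂ] K)) (fun g => (P.U.hom g : H →L[ℂ] H)) ∧
      ∀ g a, γ (CrossedProduct.of α g a) = Q.π.hom a * (Q.U.hom g : K →L[ℂ] K) := by
  set p : H →L[ℂ] H := W.comp (ContinuousLinearMap.adjoint W) with hp
  have hpW : ∀ x, p (W x) = W x := fun x => congrArg W (adjoint_apply_apply_of_norm_map hW x)
  -- the range projection commutes with `π` and `π(a) U(g)`, hence with `U`
  have hpρ : ∀ x y, p (P.toDiscrete.extendHom x y) = P.toDiscrete.extendHom x (p y) := fun x y => by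
    change W (ContinuousLinearMap.adjoint W (P.toDiscrete.extendHom x y)) = _
    rw [hγ.adjoint, hγ]
    rfl
  have hpπ : ∀ a y, p (P.π.hom a y) = P.π.hom a (p y) := fun a y => by
    have h1 := hpρ (CrossedProduct.of α 1 a) y
    rwa [DiscreteCovRep.extendHom_of_one] at h1
  have hpU : ∀ g y, p ((P.U.hom g : H →L[ℂ] H) y) = (P.U.hom g : H →L[ℂ] H) (p y) := by
    intro g y
    have h1 : p.comp (P.U.hom g : H →L[ℂ] H) = (P.U.hom g : H →L[ℂ] H).comp p := by
      refine P.π.eq_of_mul_left_eq fun a => ContinuousLinearMap.ext fun z => ?_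
      have h2 := hpρ (CrossedProduct.of α g a) z
      rw [DiscreteCovRep.extendHom_of] at h2
      exact (hpπ a _).symm.trans h2
    exact congrArg (fun S : H →L[ℂ] H => S y) h1
  have hπ : ∀ a x, p (P.π.hom a (W x)) = P.π.hom a (W x) := fun a x => by rw [hpπ, hpW]
  have hU : ∀ g x, p ((P.U.hom g : H →L[ℂ] H) (W x)) = (P.U.hom g : H →L[ℂ] H) (W x) :=
    fun g x => by rw [hpU, hpW]
  have hi : Function.Injective W := (AddMonoidHomClass.isometry_of_norm W hW).injective
  have h1 := P.π.intertwines_compress W hW hπ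
  have h2 := P.U.intertwines_compress W hW hU
  refine ⟨⟨P.π.compress W hW hπ, P.U.compress W hW hU, fun g a => ?_⟩, h1, h2, fun g a => ?_⟩
  · have h3 : ((P.U.compress W hW hU).hom g : K →L[ℂ] K) * (P.π.compress W hW hπ).hom a =
        (P.π.compress W hW hπ).hom (α g a) * ((P.U.compress W hW hU).hom g : K →L[ℂ] K) := by
      refine ContinuousLinearMap.ext fun x => hi ?_
      refine (h2 g _).trans ((congrArg _ (h1 a x)).trans ((P.U_apply_π_apply g a _).trans ?_))
      exact ((h1 _ _).trans (congrArg _ (h2 g x))).symm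
    refine (congrArg (fun S => S * star _) h3).trans ((mul_assoc _ _ _).trans ?_)
    exact (congrArg _ (Unitary.mem_iff.mp (Subtype.prop _)).2).trans (mul_one _)
  · refine ContinuousLinearMap.ext fun x => hi ?_
    rw [hγ, DiscreteCovRep.extendHom_of]
    exact ((h1 _ _).trans (congrArg _ (h2 g x))).symm

/-- Every unit vector `ξ` of a covariant `L`-representation lies in the image of an isometric
intertwiner from the GNS representation of a state in `𝔖_L`, namely of the vector state of `ξ`. -/
theorem exists_lState_isometry (𝓛 : HostAlgebra G L) {P : CovRep α H} (hP : 𝓛.IsLRep P.U) {ξ : H}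
    (hξ : ‖ξ‖ = 1) :
    ∃ (ω : lStates 𝓛 α) (W : ω.1.GNS →L[ℂ] H), (∀ x, ‖W x‖ = ‖x‖) ∧ ξ ∈ Set.range W ∧
      Intertwines W (gnsCovRep 𝓛 α ω).π.hom P.π.hom ∧
      Intertwines W (fun g => ((gnsCovRep 𝓛 α ω).U.hom g : ω.1.GNS →L[ℂ] ω.1.GNS))
        (fun g => (P.U.hom g : H →L[ℂ] H)) := by
  obtain ⟨W, hW, hWρ, hξW⟩ := exists_isometry_gns_vectorFunctional P.toDiscrete.extend.hom ξ
  obtain ⟨Q, -, hQU, hQ⟩ := P.exists_compress W hW _ hWρ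
  obtain ⟨σ, hσ⟩ := hP
  rw [← hσ] at hQU
  obtain ⟨τ, hτ, -⟩ := 𝓛.exists_pull_eq_of_intertwines σ W hW hQU
  let ω : lStates 𝓛 α :=
    ⟨vectorFunctional P.toDiscrete.extend.hom ξ, isState_vectorFunctional _ hξ, Q, ⟨τ, hτ⟩, hQ⟩
  have hgns : ∀ g a, ω.1.gnsNonUnitalStarAlgHom (CrossedProduct.of α g a) =
      (gnsCovRep 𝓛 α ω).π.hom a * ((gnsCovRep 𝓛 α ω).U.hom g : ω.1.GNS →L[ℂ] ω.1.GNS) :=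
    ω.2.2.choose_spec.2
  have h : ∀ g a x, W ((gnsCovRep 𝓛 α ω).π.hom a
      (((gnsCovRep 𝓛 α ω).U.hom g : ω.1.GNS →L[ℂ] ω.1.GNS) x)) =
        P.π.hom a ((P.U.hom g : H →L[ℂ] H) (W x)) := by
    intro g a x
    have h1 := hWρ (CrossedProduct.of α g a) x
    have h2 : P.toDiscrete.extend.hom (CrossedProduct.of α g a) =
        P.π.hom a * (P.U.hom g : H →L[ℂ] H) := P.toDiscrete.extendHom_of g a
    rw [h2] at h1
    exact (congrArg (fun S : ω.1.GNS →L[ℂ] ω.1.GNS => W (S x)) (hgns g a)).symm.trans h1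
  have hπ : Intertwines W (gnsCovRep 𝓛 α ω).π.hom P.π.hom := fun a x => by
    simpa using h 1 a x
  refine ⟨ω, W, hW, mem_range_of_isometry hW P.toDiscrete.extend hξW, hπ, fun g x => ?_⟩
  have h3 : W.comp ((gnsCovRep 𝓛 α ω).U.hom g : ω.1.GNS →L[ℂ] ω.1.GNS) =
      (P.U.hom g : H →L[ℂ] H).comp W := by
    refine P.π.eq_of_mul_left_eq fun a => ContinuousLinearMap.ext fun y => ?_
    exact (hπ a _).symm.trans (h g a y)
  exact congrArg (fun S : ω.1.GNS →L[ℂ] H => S x) h3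

end Cyclic

section Domination

/-- Pairs of operators intertwined, along with their adjoints, by an operator `V`. -/
def intertwinedPairs {H K : Type*} [NormedAddCommGroup H] [InnerProductSpace ℂ H] [CompleteSpace H]
    [NormedAddCommGroup K] [InnerProductSpace ℂ K] [CompleteSpace K] (V : K →L[ℂ] H) :
    NonUnitalStarSubalgebra ℂ ((K →L[ℂ] K) × (H →L[ℂ] H)) where
  carrier := {x | V.comp x.1 = x.2.comp V ∧ V.comp (star x.1) = (star x.2).comp V}
  add_mem' := fun {x y} hx hy => by
    simp only [Set.mem_ofPred_eq, Prod.fst_add, Prod.snd_add, star_add,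
      ContinuousLinearMap.comp_add, ContinuousLinearMap.add_comp, hx.1, hx.2, hy.1, hy.2, and_self]
  zero_mem' := by simp
  mul_mem' := fun {x y} hx hy => by
    have h : ∀ {a b : K →L[ℂ] K} {c d : H →L[ℂ] H}, V.comp a = c.comp V → V.comp b = d.comp V →
        V.comp (a * b) = (c * d).comp V := fun {a b c d} h1 h2 => by
      change (V.comp a).comp b = c.comp (d.comp V)
      rw [h1, ← h2]
      rfl
    exact ⟨h hx.1 hy.1, by
      rw [Prod.fst_mul, Prod.snd_mul, star_mul, star_mul]
      exact h hy.2 hx.2⟩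
  smul_mem' := fun c x hx => by
    simp only [Set.mem_ofPred_eq, Prod.smul_fst, Prod.smul_snd, star_smul,
      ContinuousLinearMap.comp_smul, ContinuousLinearMap.smul_comp, hx.1, hx.2, and_self]
  star_mem' := fun {x} hx => ⟨hx.2, by simpa using hx.1⟩

theorem isClosed_intertwinedPairs {H K : Type*} [NormedAddCommGroup H] [InnerProductSpace ℂ H]
    [CompleteSpace H] [NormedAddCommGroup K] [InnerProductSpace ℂ K] [CompleteSpace K]
    (V : K →L[ℂ] H) : IsClosed (intertwinedPairs V : Set ((K →L[ℂ] K) × (H →L[ℂ] H))) := by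
  have h1 : Continuous fun x : K →L[ℂ] K => V.comp x := continuous_const.clm_comp continuous_id
  have h2 : Continuous fun x : H →L[ℂ] H => x.comp V := continuous_id.clm_comp continuous_const
  exact (isClosed_eq (h1.comp continuous_fst) (h2.comp continuous_snd)).inter
    (isClosed_eq (h1.comp (continuous_star.comp continuous_fst))
      (h2.comp (continuous_star.comp continuous_snd)))

variable {G A L : Type u} [Group G] [TopologicalSpace G] [NonUnitalCStarAlgebra A]
  [NonUnitalCStarAlgebra L] {α : G →* (A ≃⋆ₐ[ℂ] A)}
  {H : Type u} [NormedAddCommGroup H] [InnerProductSpace ℂ H] [CompleteSpace H]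

/-- An isometric intertwiner from a summand extends by zero to a contractive intertwiner from the
direct sum. -/
theorem exists_intertwiner_directSum (𝓛 : HostAlgebra G L) {ι : Type u} {K : ι → Type u}
    [∀ i, NormedAddCommGroup (K i)] [∀ i, InnerProductSpace ℂ (K i)] [∀ i, CompleteSpace (K i)]
    (Q : ∀ i, CovRep α (K i)) (hQ : ∀ i, 𝓛.IsLRep (Q i).U)
    (hu : 𝓛.IsLRep (CovRep.directSum Q).U) {P : CovRep α H} (hP : 𝓛.IsLRep P.U) (i : ι)
    {W : K i →L[ℂ] H} (hW : ∀ x, ‖W x‖ = ‖x‖) (hWπ : Intertwines W (Q i).π.hom P.π.hom)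
    (hWU : Intertwines W (fun g => ((Q i).U.hom g : K i →L[ℂ] K i))
      (fun g => (P.U.hom g : H →L[ℂ] H))) :
    ∃ V : lp K 2 →L[ℂ] H, (∀ x, ‖V x‖ ≤ ‖x‖) ∧ (∀ x, ∃ y, ‖y‖ = ‖x‖ ∧ V y = W x) ∧
      Intertwines V (CovRep.directSum Q).π.hom P.π.hom ∧
      Intertwines V (𝓛.lift hu).hom (𝓛.lift hP).hom := by
  classical
  let J : K i →L[ℂ] lp K 2 := lp.singleContinuousLinearMap ℂ K 2 i
  have hJ : ∀ y, ‖J y‖ = ‖y‖ := fun y => lp.norm_single (by norm_num) i y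
  have hJπ : Intertwines J (Q i).π.hom (CovRep.directSum Q).π.hom := fun a y =>
    (diagOp_single (fun i => (Q i).π.hom a)
      ⟨‖a‖, fun i => NonUnitalStarAlgHom.norm_apply_le (Q i).π.hom a⟩ i y).symm
  have hJU : Intertwines J (fun g => ((Q i).U.hom g : K i →L[ℂ] K i))
      (fun g => ((CovRep.directSum Q).U.hom g : lp K 2 →L[ℂ] lp K 2)) := fun g y =>
    (diagOp_single (fun i => ((Q i).U.hom g : K i →L[ℂ] K i))
      ⟨1, fun i => unitary_norm_le _⟩ i y).symm
  have hJL := 𝓛.intertwines_lift (hQ i) hu hJ hJU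
  have hWL := 𝓛.intertwines_lift (hQ i) hP hW hWU
  refine ⟨W.comp (ContinuousLinearMap.adjoint J), fun y => ?_, fun x => ⟨J x, hJ x, ?_⟩,
    fun a y => ?_, fun l y => ?_⟩
  · exact (hW _).trans_le (norm_adjoint_apply_le_of_norm_map hJ y)
  · exact congrArg W (adjoint_apply_apply_of_norm_map hJ x)
  · exact (congrArg W (hJπ.adjoint a y)).trans (hWπ a _)
  · exact (congrArg W (hJL.adjoint l y)).trans (hWL l _)

/-- Each unit vector `ξ` of a covariant `L`-representation is the image of a unit vector of `H_u`
under a contractive intertwiner: the projection onto the GNS space of the vector state of `ξ`,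
followed by the isometry onto the cyclic subspace of `ξ`. -/
theorem exists_intertwiner_universalRep (𝓛 : HostAlgebra G L) (P : CovRep α H)
    (hP : 𝓛.IsLRep P.U) (hu : 𝓛.IsLRep (universalRep 𝓛 α).U) {ξ : H} (hξ : ‖ξ‖ = 1) :
    ∃ V : UniversalSpace 𝓛 α →L[ℂ] H, (∀ x, ‖V x‖ ≤ ‖x‖) ∧ (∃ x, ‖x‖ = 1 ∧ V x = ξ) ∧
      Intertwines V (universalRep 𝓛 α).π.hom P.π.hom ∧
      Intertwines V (𝓛.lift hu).hom (𝓛.lift hP).hom := by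
  obtain ⟨ω, W, hW, ⟨x, hx⟩, hWπ, hWU⟩ := exists_lState_isometry 𝓛 hP hξ
  obtain ⟨V, hV, hVW, hVπ, hVL⟩ := exists_intertwiner_directSum 𝓛 (gnsCovRep 𝓛 α)
    (fun ω => ω.2.2.choose_spec.1) hu hP ω hW hWπ hWU
  obtain ⟨y, hy, hVy⟩ := hVW x
  exact ⟨V, hV, ⟨y, by rw [hy, ← hW, hx, hξ], hVy.trans hx⟩, hVπ, hVL⟩

/-- The universal representation dominates every covariant `L`-representation, on the `C⋆`-algebra
generated by the products `π(a) U_L(l)`. -/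
theorem norm_snd_le_norm_fst_universalRep (𝓛 : HostAlgebra G L) (P : CovRep α H)
    (hP : 𝓛.IsLRep P.U) (hu : 𝓛.IsLRep (universalRep 𝓛 α).U) :
    ∀ x ∈ (NonUnitalStarAlgebra.adjoin ℂ (Set.range fun p : A × L =>
      ((universalRep 𝓛 α).π.hom p.1 * (𝓛.lift hu).hom p.2,
        P.π.hom p.1 * (𝓛.lift hP).hom p.2))).topologicalClosure, ‖x.2‖ ≤ ‖x.1‖ := by
  intro x hx
  have key : ∀ ξ : H, ‖ξ‖ = 1 → ‖x.2 ξ‖ ≤ ‖x.1‖ := by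
    intro ξ hξ
    obtain ⟨V, hV, ⟨y, hy, rfl⟩, hVπ, hVL⟩ := exists_intertwiner_universalRep 𝓛 P hP hu hξ
    have h1 : (NonUnitalStarAlgebra.adjoin ℂ (Set.range fun p : A × L =>
        ((universalRep 𝓛 α).π.hom p.1 * (𝓛.lift hu).hom p.2,
          P.π.hom p.1 * (𝓛.lift hP).hom p.2))).topologicalClosure ≤ intertwinedPairs V := by
      refine NonUnitalStarSubalgebra.topologicalClosure_minimal _
        (NonUnitalStarAlgebra.adjoin_le ?_) (isClosed_intertwinedPairs V)
      rintro _ ⟨p, rfl⟩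
      refine ⟨ContinuousLinearMap.ext fun z => ?_, ContinuousLinearMap.ext fun z => ?_⟩
      · exact (hVπ p.1 _).trans (congrArg _ (hVL p.2 z))
      · simp only [star_mul, ← map_star]
        exact (hVL _ _).trans (congrArg _ (hVπ _ z))
    have h2 : V (x.1 y) = x.2 (V y) :=
      congrArg (fun S : UniversalSpace 𝓛 α →L[ℂ] H => S y) (h1 hx).1
    rw [← h2]
    calc ‖V (x.1 y)‖ ≤ ‖x.1 y‖ := hV _
      _ ≤ ‖x.1‖ * ‖y‖ := x.1.le_opNorm y
      _ = ‖x.1‖ := by rw [hy, mul_one]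
  exact ContinuousLinearMap.opNorm_le_of_unit_norm (norm_nonneg _) key

end Domination

theorem mainTheorem2 {G A L : Type u} [Group G] [TopologicalSpace G] [IsTopologicalGroup G]
    [NonUnitalCStarAlgebra A] [NonUnitalCStarAlgebra L]
    (𝓛 : HostAlgebra G L) (α : G →* (A ≃⋆ₐ[ℂ] A)) :
    List.TFAE [
      ∃ (C : Type u) (_ : NonUnitalCStarAlgebra C) (K : CrossedProductHost 𝓛 α C), K.IsFull,
      universalRep 𝓛 α ∈ crossReps 𝓛 α (UniversalSpace 𝓛 α),
      ∀ (H : Type u) [NormedAddCommGroup H] [InnerProductSpace ℂ H] [CompleteSpace H],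
        covLReps 𝓛 α H = crossReps 𝓛 α H] := by
  have hu : 𝓛.IsLRep (universalRep 𝓛 α).U := universalRep_mem_covLReps 𝓛 α
  tfae_have 1 → 3 := by
    rintro ⟨C, _, K, hK⟩ H _ _ _
    exact Set.Subset.antisymm (fun P hP => hK.mem_crossReps hP) fun P ⟨hU, _⟩ => hU
  tfae_have 3 → 2 := by
    intro h
    rw [← h]
    exact hu
  tfae_have 2 → 1 := fun h => ⟨_, inferInstance, crossedHost _ h hu,
    isFull_crossedHost h hu fun K _ _ _ Q hQ => norm_snd_le_norm_fst_universalRep 𝓛 Q hQ hu⟩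
  tfae_finish
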